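/- Let $X$ be a real Banach lattice and let $X_{\mathbb C}=X\oplus iX$ be its complexification, a complex Banach lattice with modulus $|x+iy|=\sup_{\theta\in[0,2\pi]}(x\cos\theta+y\sin\theta)$ and norm $\|z\|=\||z|\|_X$. For a complex Banach space $E$, let $E_{\mathbb R}$ be $E$ regarded as a real Banach space, and let $\mathrm{FBL}[E_{\mathbb R}]$ be the closed sublattice generated by the evaluations $\delta_{E_{\mathbb R}}(z)\colon x^*\mapsto x^*(z)$, $z\in E$, in the Banach lattice (with the pointwise order) of all positively homogeneous functions $f\colon (E_{\mathbb R})^*\to\mathbb R$ with $$\sup\Big\{\sum_{j=1}^m|f(x_j^*)| : m\in\mathbb N,\ x_1^*,\dots,x_m^*\in (E_{\mathbb R})^*,\ \sup_{\|z\|\le 1}\sum_{j=1}^m|x_j^*(z)|\le 1\Big\}<\infty,$$ normed by this supremum. The free complex Banach lattice $\mathrm{FBL}_{\mathbb C}[E]$ is the complexification of $\mathrm{FBL}[E_{\mathbb R}]$ equipped with the (equivalent) norm $$\|f\|=\sup\Big\{\sum_{j=1}^m|f(\mathrm{Re}\,z_j^*)| : m\in\mathbb N,\ z_1^*,\dots,z_m^*\in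 E^*,\ \sup_{\|z\|\le 1}\sum_{j=1}^m|z_j^*(z)|\le 1\Big\},$$ together with the $\mathbb C$-linear embedding $\delta_E(z)=\delta_{E_{\mathbb R}}(z)-i\,\delta_{E_{\mathbb R}}(iz)$. For a bounded linear operator $T\colon E\to E$, let $\overline T\colon \mathrm{FBL}_{\mathbb C}[E]\to \mathrm{FBL}_{\mathbb C}[E]$ be the unique (complex) lattice homomorphism with $\overline T\circ\delta_E=\delta_E\circ T$; here a complex lattice homomorphism is the complexification of a bounded real lattice homomorphism. If $T\colon X_{\mathbb C}\to X_{\mathbb C}$ is a complex lattice homomorphism, then $$\sigma(T)\subset\sigma(\overline T),$$ where $\sigma(S)=\{\lambda\in\mathbb C : \lambda I-S \text{ is not invertible}\}$ denotes the spectrum of a bounded operator $S$. -/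

import Mathlib

open Filter Topology

open scoped ENNReal

/-- The complexification `X ⊕ iX` of `X`; the pair `⟨x, y⟩` stands for `x + iy`. -/
@[ext]
structure Cplx (X : Type*) where
  /-- real part -/
  re : X
  /-- imaginary part -/
  im : X

namespace Cplx

section Algebra

variable {X : Type*} [AddCommGroup X]

instance : Zero (Cplx X) := ⟨⟨0, 0⟩⟩
instance : Add (Cplx X) := ⟨fun z w => ⟨z.re + w.re, z.im + w.im⟩⟩
instance : Neg (Cplx X) := ⟨fun z => ⟨-z.re, -z.im⟩⟩
instance : Sub (Cplx X) := ⟨fun z w => ⟨z.re - w.re, z.im - w.im⟩⟩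

@[simp] theorem zero_re : (0 : Cplx X).re = 0 := rfl
@[simp] theorem zero_im : (0 : Cplx X).im = 0 := rfl
@[simp] theorem add_re (z w : Cplx X) : (z + w).re = z.re + w.re := rfl
@[simp] theorem add_im (z w : Cplx X) : (z + w).im = z.im + w.im := rfl
@[simp] theorem neg_re (z : Cplx X) : (-z).re = -z.re := rfl
@[simp] theorem neg_im (z : Cplx X) : (-z).im = -z.im := rfl
@[simp] theorem sub_re (z w : Cplx X) : (z - w).re = z.re - w.re := rfl
@[simp] theorem sub_im (z w : Cplx X) : (z - w).im = z.im - w.im := rfl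

instance : AddCommGroup (Cplx X) where
  add_assoc a b c := by ext <;> simp [add_assoc]
  zero_add a := by ext <;> simp
  add_zero a := by ext <;> simp
  nsmul := nsmulRec
  zsmul := zsmulRec
  neg_add_cancel a := by ext <;> simp
  add_comm a b := by ext <;> simp [add_comm]
  sub_eq_add_neg a b := by ext <;> simp [sub_eq_add_neg]

variable [Module ℝ X]

instance : SMul ℂ (Cplx X) :=
  ⟨fun c z => ⟨c.re • z.re - c.im • z.im, c.im • z.re + c.re • z.im⟩⟩

@[simp] theorem smul_re (c : ℂ) (z : Cplx X) : (c • z).re = c.re • z.re - c.im • z.im := rfl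
@[simp] theorem smul_im (c : ℂ) (z : Cplx X) : (c • z).im = c.im • z.re + c.re • z.im := rfl

instance : Module ℂ (Cplx X) where
  one_smul z := by ext <;> simp
  mul_smul c d z := by ext <;> simp <;> module
  smul_zero c := by ext <;> simp
  smul_add c z w := by ext <;> simp <;> module
  add_smul c d z := by ext <;> simp <;> module
  zero_smul z := by ext <;> simp

end Algebra

section Norm

variable {X : Type*} [NormedAddCommGroup X] [NormedSpace ℝ X] [Lattice X] [HasSolidNorm X]
  [IsOrderedAddMonoid X] [IsOrderedModule ℝ X]

/-- The set `{x cos θ + y sin θ}` whose supremum is the modulus of `x + iy`. By periodicity it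
does not matter whether `θ` ranges over `[0, 2π]` or over `ℝ`. -/
def rotations (z : Cplx X) : Set X :=
  Set.range fun θ : ℝ => Real.cos θ • z.re + Real.sin θ • z.im

theorem rot_le (z : Cplx X) (θ φ : ℝ) :
    Real.cos θ • z.re + Real.sin θ • z.im ≤
      (Real.cos φ • z.re + Real.sin φ • z.im) + |θ - φ| • (|z.re| + |z.im|) := by
  have key : ∀ (a b : ℝ) (x : X), |a - b| ≤ |θ - φ| → a • x ≤ b • x + |θ - φ| • |x| := by
    intro a b x h
    have h1 : (a - b) • x ≤ |a - b| • |x| := by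
      rcases le_total 0 (a - b) with h0 | h0
      · rw [abs_of_nonneg h0]
        exact smul_le_smul_of_nonneg_left (le_abs_self x) h0
      · rw [abs_of_nonpos h0]
        have : (a - b) • x = (-(a - b)) • (-x) := by module
        rw [this]
        exact smul_le_smul_of_nonneg_left (neg_le_abs x) (by linarith)
    have h2 : |a - b| • |x| ≤ |θ - φ| • |x| := smul_le_smul_of_nonneg_right h (abs_nonneg x)
    have h3 := h1.trans h2
    rw [sub_smul, sub_le_iff_le_add'] at h3
    exact h3
  have hc := key (Real.cos θ) (Real.cos φ) z.re (by
    simpa [Real.dist_eq] using (Real.lipschitzWith_cos.dist_le_mul θ φ))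
  have hs := key (Real.sin θ) (Real.sin φ) z.im (by
    simpa [Real.dist_eq] using (Real.lipschitzWith_sin.dist_le_mul θ φ))
  refine (add_le_add hc hs).trans (le_of_eq ?_)
  module

theorem exists_isLUB_rotations [CompleteSpace X] (z : Cplx X) : ∃ m, IsLUB (rotations z) m := by
  set f : ℝ → X := fun θ => Real.cos θ • z.re + Real.sin θ • z.im with hf
  set u : X := |z.re| + |z.im| with hu
  have hu0 : 0 ≤ u := add_nonneg (abs_nonneg _) (abs_nonneg _)
  set s : ℕ → X := fun n => (Finset.range (n + 1)).sup' ⟨0, by simp⟩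
    (fun k : ℕ => f (2 * Real.pi * ((k : ℝ) / ((n : ℝ) + 1)))) with hs
  set c : ℕ → ℝ := fun n => 2 * Real.pi * (1 / ((n : ℝ) + 1)) with hc
  have hc0 : ∀ n, 0 ≤ c n := fun n => by positivity
  have hclim : Tendsto c atTop (𝓝 0) := by
    simpa [hc] using tendsto_one_div_add_atTop_nhds_zero_nat.const_mul (2 * Real.pi)
  have hcanti : ∀ m n, m ≤ n → c n ≤ c m := by
    intro m n h
    have : (m : ℝ) ≤ n := by exact_mod_cast h
    simp only [hc]
    gcongr
  have h1 : ∀ θ n, f θ ≤ s n + c n • u := by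
    intro θ n
    set t := Int.fract (θ / (2 * Real.pi)) with ht
    have ht0 : 0 ≤ t := Int.fract_nonneg _
    have ht1 : t < 1 := Int.fract_lt_one _
    have hn : (0 : ℝ) < (n : ℝ) + 1 := by positivity
    set k := ⌊t * ((n : ℝ) + 1)⌋₊ with hk
    have hk1 : (k : ℝ) ≤ t * (n + 1) := Nat.floor_le (by positivity)
    have hk2 : t * (n + 1) < k + 1 := Nat.lt_floor_add_one _
    have hkn : k < n + 1 := by
      have : (k : ℝ) < (n : ℝ) + 1 := lt_of_le_of_lt hk1 (by nlinarith)
      exact_mod_cast this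
    have hft : f θ = f (2 * Real.pi * t) := by
      have : θ = 2 * Real.pi * t + ⌊θ / (2 * Real.pi)⌋ * (2 * Real.pi) := by
        have h := Int.floor_add_fract (θ / (2 * Real.pi))
        have h2 : θ = 2 * Real.pi * (θ / (2 * Real.pi)) := by field_simp
        rw [← ht] at h
        linear_combination h2 - 2 * Real.pi * h
      simp only [hf]
      rw [this, Real.cos_add_int_mul_two_pi, Real.sin_add_int_mul_two_pi]
    rw [hft]
    refine (rot_le z _ (2 * Real.pi * ((k : ℝ) / ((n : ℝ) + 1)))).trans ?_
    refine add_le_add ?_ ?_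
    · exact Finset.le_sup' (fun k : ℕ => f (2 * Real.pi * ((k : ℝ) / ((n : ℝ) + 1))))
        (Finset.mem_range.2 hkn)
    · refine smul_le_smul_of_nonneg_right ?_ hu0
      rw [← mul_sub, abs_mul, abs_of_pos (by positivity : (0 : ℝ) < 2 * Real.pi)]
      refine mul_le_mul_of_nonneg_left ?_ (by positivity)
      have hd : t - (k : ℝ) / ((n : ℝ) + 1) = (t * (n + 1) - k) / ((n : ℝ) + 1) := by field_simp
      rw [hd, abs_of_nonneg (div_nonneg (by linarith) hn.le)]
      exact div_le_div_of_nonneg_right (by linarith) hn.le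
  have h2 : ∀ m n, s m ≤ s n + c n • u := fun m n => Finset.sup'_le _ _ fun k _ => h1 _ n
  have hcau : CauchySeq s := by
    refine cauchySeq_of_le_tendsto_0 (fun n => c n * ‖u‖) ?_ (by simpa using hclim.mul_const ‖u‖)
    intro n m N hn hm
    rw [dist_eq_norm]
    have : |s n - s m| ≤ |c N • u| := by
      rw [abs_of_nonneg (smul_nonneg (hc0 N) hu0)]
      refine abs_le'.2 ⟨?_, ?_⟩
      · rw [sub_le_iff_le_add']
        exact (h2 n m).trans (add_le_add le_rfl (smul_le_smul_of_nonneg_right (hcanti _ _ hm) hu0))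
      · rw [neg_sub, sub_le_iff_le_add']
        exact (h2 m n).trans (add_le_add le_rfl (smul_le_smul_of_nonneg_right (hcanti _ _ hn) hu0))
    refine (norm_le_norm_of_abs_le_abs this).trans ?_
    rw [norm_smul, Real.norm_of_nonneg (hc0 N)]
  obtain ⟨m, hm⟩ := cauchySeq_tendsto_of_complete hcau
  refine ⟨m, ?_, ?_⟩
  · rintro _ ⟨θ, rfl⟩
    have hlim : Tendsto (fun n => s n + c n • u) atTop (𝓝 (m + (0 : ℝ) • u)) :=
      hm.add (hclim.smul_const u)
    rw [zero_smul, add_zero] at hlim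
    exact ge_of_tendsto' hlim (h1 θ)
  · intro b hb
    refine le_of_tendsto' hm fun n => Finset.sup'_le _ _ fun k _ => hb ⟨_, rfl⟩

variable [CompleteSpace X]

/-- The modulus `|x + iy| = sup_θ (x cos θ + y sin θ)`. -/
noncomputable def modulus (z : Cplx X) : X := (exists_isLUB_rotations z).choose

theorem isLUB_modulus (z : Cplx X) : IsLUB (rotations z) (modulus z) :=
  (exists_isLUB_rotations z).choose_spec

theorem rot_le_modulus (z : Cplx X) (θ : ℝ) :
    Real.cos θ • z.re + Real.sin θ • z.im ≤ modulus z := (isLUB_modulus z).1 ⟨θ, rfl⟩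

theorem modulus_le {z : Cplx X} {b : X}
    (h : ∀ θ : ℝ, Real.cos θ • z.re + Real.sin θ • z.im ≤ b) : modulus z ≤ b :=
  (isLUB_modulus z).2 (by rintro _ ⟨θ, rfl⟩; exact h θ)

theorem abs_re_le_modulus (z : Cplx X) : |z.re| ≤ modulus z :=
  abs_le'.2 ⟨by simpa using rot_le_modulus z 0, by simpa using rot_le_modulus z Real.pi⟩

theorem abs_im_le_modulus (z : Cplx X) : |z.im| ≤ modulus z :=
  abs_le'.2 ⟨by simpa using rot_le_modulus z (Real.pi / 2), by
    simpa [Real.cos_neg, Real.sin_neg] using rot_le_modulus z (-(Real.pi / 2))⟩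

theorem modulus_nonneg (z : Cplx X) : 0 ≤ modulus z :=
  (abs_nonneg _).trans (abs_re_le_modulus z)

theorem modulus_le_add (z : Cplx X) : modulus z ≤ |z.re| + |z.im| := by
  have key : ∀ (a : ℝ) (x : X), |a| ≤ 1 → a • x ≤ |x| := by
    intro a x h
    rcases le_total 0 a with h0 | h0
    · rw [abs_of_nonneg h0] at h
      calc a • x ≤ a • |x| := smul_le_smul_of_nonneg_left (le_abs_self x) h0
        _ ≤ (1 : ℝ) • |x| := smul_le_smul_of_nonneg_right h (abs_nonneg x)
        _ = |x| := one_smul _ _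
    · rw [abs_of_nonpos h0] at h
      calc a • x = (-a) • (-x) := by module
        _ ≤ (-a) • |x| := smul_le_smul_of_nonneg_left (neg_le_abs x) (by linarith)
        _ ≤ (1 : ℝ) • |x| := smul_le_smul_of_nonneg_right h (abs_nonneg x)
        _ = |x| := one_smul _ _
  exact modulus_le fun θ =>
    add_le_add (key _ _ (Real.abs_cos_le_one θ)) (key _ _ (Real.abs_sin_le_one θ))

theorem modulus_add_le (z w : Cplx X) : modulus (z + w) ≤ modulus z + modulus w :=
  modulus_le fun θ => by
    refine le_trans (le_of_eq ?_) (add_le_add (rot_le_modulus z θ) (rot_le_modulus w θ))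
    simp only [add_re, add_im]
    module

theorem modulus_smul_le (c : ℂ) (z : Cplx X) : modulus (c • z) ≤ ‖c‖ • modulus z :=
  modulus_le fun θ => by
    refine le_trans (le_of_eq ?_)
      (smul_le_smul_of_nonneg_left (rot_le_modulus z (θ - c.arg)) (norm_nonneg c))
    have h1 : c.re = ‖c‖ * Real.cos c.arg := (Complex.norm_mul_cos_arg c).symm
    have h2 : c.im = ‖c‖ * Real.sin c.arg := (Complex.norm_mul_sin_arg c).symm
    simp only [smul_re, smul_im]
    rw [Real.cos_sub, Real.sin_sub, h1, h2]
    module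

theorem modulus_neg_le (z : Cplx X) : modulus (-z) ≤ modulus z := by
  simpa using modulus_smul_le (-1) z

noncomputable instance : Norm (Cplx X) := ⟨fun z => ‖modulus z‖⟩

/-- The norm of a complex Banach lattice is the norm of the modulus. -/
theorem norm_def (z : Cplx X) : ‖z‖ = ‖modulus z‖ := rfl

theorem norm_le_norm_of_le {a b : X} (ha : 0 ≤ a) (h : a ≤ b) : ‖a‖ ≤ ‖b‖ :=
  norm_le_norm_of_abs_le_abs (by rwa [abs_of_nonneg ha, abs_of_nonneg (ha.trans h)])

theorem norm_re_le' (z : Cplx X) : ‖z.re‖ ≤ ‖modulus z‖ :=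
  norm_le_norm_of_abs_le_abs (by
    rw [abs_of_nonneg (modulus_nonneg z)]; exact abs_re_le_modulus z)

theorem norm_im_le' (z : Cplx X) : ‖z.im‖ ≤ ‖modulus z‖ :=
  norm_le_norm_of_abs_le_abs (by
    rw [abs_of_nonneg (modulus_nonneg z)]; exact abs_im_le_modulus z)

noncomputable instance : NormedAddCommGroup (Cplx X) :=
  AddGroupNorm.toNormedAddCommGroup
    { toFun := fun z => ‖modulus z‖
      map_zero' := by
        have : modulus (0 : Cplx X) = 0 :=
          le_antisymm (modulus_le fun θ => by simp) (modulus_nonneg _)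
        simp [this]
      add_le' := fun z w =>
        (norm_le_norm_of_le (modulus_nonneg _) (modulus_add_le z w)).trans (norm_add_le _ _)
      neg' := fun z => by
        rw [le_antisymm (modulus_neg_le z) (by simpa using modulus_neg_le (-z))]
      eq_zero_of_map_eq_zero' := fun z h => by
        have h1 := norm_re_le' z
        have h2 := norm_im_le' z
        rw [h] at h1 h2
        ext
        · simpa using h1
        · simpa using h2 }

noncomputable instance : NormedSpace ℂ (Cplx X) where
  norm_smul_le c z := by
    refine (norm_le_norm_of_le (modulus_nonneg _) (modulus_smul_le c z)).trans (le_of_eq ?_)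
    rw [norm_smul, norm_norm]
    rfl

theorem norm_re_le (z : Cplx X) : ‖z.re‖ ≤ ‖z‖ := norm_re_le' z

theorem norm_im_le (z : Cplx X) : ‖z.im‖ ≤ ‖z‖ := norm_im_le' z

theorem norm_le_add (z : Cplx X) : ‖z‖ ≤ ‖z.re‖ + ‖z.im‖ := by
  refine (norm_le_norm_of_le (modulus_nonneg _) (modulus_le_add z)).trans ?_
  refine (norm_add_le _ _).trans (le_of_eq ?_)
  rw [norm_abs_eq_norm, norm_abs_eq_norm]

instance : CompleteSpace (Cplx X) := by
  refine Metric.complete_of_cauchySeq_tendsto fun u hu => ?_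
  have key : ∀ p : Cplx X →+ X, (∀ z, ‖p z‖ ≤ ‖z‖) →
      ∃ a, Tendsto (fun n => p (u n)) atTop (𝓝 a) := by
    intro p hp
    have hl : LipschitzWith 1 p :=
      (AddMonoidHomClass.lipschitz_of_bound p 1 (by simpa using hp)).weaken (by simp)
    exact cauchySeq_tendsto_of_complete (hl.uniformContinuous.comp_cauchySeq hu)
  obtain ⟨a, ha⟩ := key ⟨⟨Cplx.re, rfl⟩, fun _ _ => rfl⟩ norm_re_le
  obtain ⟨b, hb⟩ := key ⟨⟨Cplx.im, rfl⟩, fun _ _ => rfl⟩ norm_im_le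
  have ha' := tendsto_iff_norm_sub_tendsto_zero.1 ha
  have hb' := tendsto_iff_norm_sub_tendsto_zero.1 hb
  have hab := ha'.add hb'
  rw [add_zero] at hab
  refine ⟨⟨a, b⟩, tendsto_iff_norm_sub_tendsto_zero.2 ?_⟩
  refine squeeze_zero (fun _ => norm_nonneg _) (fun n => ?_) hab
  have h := norm_le_add (u n - ⟨a, b⟩)
  rw [sub_re, sub_im] at h
  exact h

end Norm

section Operators

variable {X : Type*} [NormedAddCommGroup X] [NormedSpace ℝ X] [Lattice X] [HasSolidNorm X]
  [IsOrderedAddMonoid X] [IsOrderedModule ℝ X] [CompleteSpace X]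
variable {Y : Type*} [NormedAddCommGroup Y] [NormedSpace ℝ Y] [Lattice Y] [HasSolidNorm Y]
  [IsOrderedAddMonoid Y] [IsOrderedModule ℝ Y] [CompleteSpace Y]

/-- The complexification `x + iy ↦ S x + i S y` of a real operator `S`. -/
noncomputable def map (S : X →L[ℝ] Y) : Cplx X →L[ℂ] Cplx Y :=
  LinearMap.mkContinuous
    { toFun := fun z => ⟨S z.re, S z.im⟩
      map_add' := fun z w => by ext <;> simp
      map_smul' := fun c z => by ext <;> simp }
    (‖S‖ + ‖S‖) (fun z => by
      refine (norm_le_add _).trans ?_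
      rw [add_mul]
      exact add_le_add
        ((S.le_opNorm _).trans (mul_le_mul_of_nonneg_left (norm_re_le z) (norm_nonneg S)))
        ((S.le_opNorm _).trans (mul_le_mul_of_nonneg_left (norm_im_le z) (norm_nonneg S))))

@[simp] theorem map_apply (S : X →L[ℝ] Y) (z : Cplx X) : map S z = ⟨S z.re, S z.im⟩ := rfl

/-- A complex lattice homomorphism: the complexification of a real lattice homomorphism. -/
def IsLatticeHom (T : Cplx X →L[ℂ] Cplx Y) : Prop :=
  ∃ S : X →L[ℝ] Y, (∀ x y, S (x ⊔ y) = S x ⊔ S y) ∧ (∀ x y, S (x ⊓ y) = S x ⊓ S y) ∧ T = map S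

end Operators

end Cplx

namespace FreeBL

section TupleNorm

/-- The finite tuples of functionals `x₁*, …, xₙ*` with `∑ |xⱼ*(v)| ≤ 1` on the unit ball. -/
def weakUnit (𝕜 E : Type*) [RCLike 𝕜] [NormedAddCommGroup E] [NormedSpace 𝕜 E] :
    Set (Σ n : ℕ, Fin n → StrongDual 𝕜 E) :=
  {a | ∀ v : E, ‖v‖ ≤ 1 → ∑ j, ‖a.2 j v‖ ≤ 1}

variable {W : Type*}

/-- `sup ∑ |f(xⱼ)|`, the supremum over the tuples in `A`, with values in `[0, ∞]`. -/
noncomputable def tupleNorm (A : Set (Σ n : ℕ, Fin n → W)) (f : W → ℝ) : ℝ≥0∞ :=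
  ⨆ a ∈ A, ENNReal.ofReal (∑ j, |f (a.2 j)|)

variable {A : Set (Σ n : ℕ, Fin n → W)}

theorem le_tupleNorm {a : Σ n : ℕ, Fin n → W} (ha : a ∈ A) (f : W → ℝ) :
    ENNReal.ofReal (∑ j, |f (a.2 j)|) ≤ tupleNorm A f :=
  le_iSup₂ (f := fun a (_ : a ∈ A) => ENNReal.ofReal (∑ j, |f (a.2 j)|)) a ha

theorem tupleNorm_le {f : W → ℝ} {c : ℝ≥0∞}
    (h : ∀ a ∈ A, ENNReal.ofReal (∑ j, |f (a.2 j)|) ≤ c) : tupleNorm A f ≤ c :=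
  iSup₂_le h

theorem tupleNorm_mono {f g : W → ℝ} (h : ∀ w, |f w| ≤ |g w|) : tupleNorm A f ≤ tupleNorm A g :=
  tupleNorm_le fun _ ha => (ENNReal.ofReal_le_ofReal (Finset.sum_le_sum fun _ _ => h _)).trans
    (le_tupleNorm ha g)

theorem tupleNorm_add_of_le {f g h : W → ℝ} (H : ∀ w, |f w| ≤ |g w| + |h w|) :
    tupleNorm A f ≤ tupleNorm A g + tupleNorm A h :=
  tupleNorm_le fun a ha => by
    refine le_trans ?_ (add_le_add (le_tupleNorm ha g) (le_tupleNorm ha h))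
    rw [← ENNReal.ofReal_add (Finset.sum_nonneg fun _ _ => abs_nonneg _)
      (Finset.sum_nonneg fun _ _ => abs_nonneg _), ← Finset.sum_add_distrib]
    exact ENNReal.ofReal_le_ofReal (Finset.sum_le_sum fun _ _ => H _)

theorem tupleNorm_add_le (f g : W → ℝ) : tupleNorm A (f + g) ≤ tupleNorm A f + tupleNorm A g :=
  tupleNorm_add_of_le fun _ => abs_add_le _ _

theorem tupleNorm_smul_le (c : ℝ) (f : W → ℝ) :
    tupleNorm A (c • f) ≤ ENNReal.ofReal |c| * tupleNorm A f :=
  tupleNorm_le fun a ha => by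
    refine le_trans (le_of_eq ?_) (mul_le_mul_right (le_tupleNorm ha f) _)
    rw [← ENNReal.ofReal_mul (abs_nonneg c), Finset.mul_sum]
    simp [abs_mul]

theorem tupleNorm_zero : tupleNorm A (0 : W → ℝ) = 0 :=
  le_antisymm (tupleNorm_le fun a _ => by simp) bot_le

/-- Comparison of two such norms along a map of tuples that scales by `c`. -/
theorem tupleNorm_le_mul {V : Type*} {B : Set (Σ n : ℕ, Fin n → V)} {f : W → ℝ} {g : V → ℝ}
    {c : ℝ} (hc : 0 ≤ c) (p : W → V) 
    (hp : ∀ a ∈ A, (⟨a.1, fun j => p (a.2 j)⟩ : Σ n : ℕ, Fin n → V) ∈ B)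
    (h : ∀ w, |f w| ≤ c * |g (p w)|) : tupleNorm A f ≤ ENNReal.ofReal c * tupleNorm B g :=
  tupleNorm_le fun a ha => by
    refine le_trans ?_ (mul_le_mul_right (le_tupleNorm (hp a ha) g) _)
    rw [← ENNReal.ofReal_mul hc, Finset.mul_sum]
    exact ENNReal.ofReal_le_ofReal (Finset.sum_le_sum fun _ _ => h _)

end TupleNorm

section Real

variable (F : Type*) [NormedAddCommGroup F] [NormedSpace ℝ F]

/-- The space `H₁[F]` of positively homogeneous functions on `F*` of finite free norm. -/
def H1 : Submodule ℝ (StrongDual ℝ F → ℝ) where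
  carrier := {f | (∀ (c : ℝ) (φ : StrongDual ℝ F), 0 ≤ c → f (c • φ) = c * f φ) ∧
    tupleNorm (weakUnit ℝ F) f < ⊤}
  zero_mem' := ⟨fun _ _ _ => by simp, by rw [tupleNorm_zero]; exact ENNReal.zero_lt_top⟩
  add_mem' := fun {f g} hf hg =>
    ⟨fun c φ hc => by simp [hf.1 c φ hc, hg.1 c φ hc, mul_add],
      (tupleNorm_add_le f g).trans_lt (ENNReal.add_lt_top.2 ⟨hf.2, hg.2⟩)⟩
  smul_mem' := fun r f hf =>
    ⟨fun c φ hc => by simp only [Pi.smul_apply, smul_eq_mul, hf.1 c φ hc]; ring,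
      (tupleNorm_smul_le r f).trans_lt (ENNReal.mul_lt_top ENNReal.ofReal_lt_top hf.2)⟩

variable {F} in
/-- The evaluation function `δ_x` on `F*`. -/
def eval (x : F) : StrongDual ℝ F → ℝ := fun φ => φ x

/-- The vector sublattice of functions on `F*` generated by the evaluations `δ_x`, `x ∈ F`. -/
def generated : Submodule ℝ (StrongDual ℝ F → ℝ) :=
  sInf {M | (∀ x : F, eval x ∈ M) ∧ ∀ f ∈ M, ∀ g ∈ M, f ⊔ g ∈ M}

/-- The real free Banach lattice `FBL[F]` as a set of functions on `F*`: the closed sublattice of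
`H₁[F]` generated by the evaluations. -/
def FBL : Submodule ℝ (StrongDual ℝ F → ℝ) where
  carrier := {f | f ∈ H1 F ∧
    ∀ ε : ℝ≥0∞, 0 < ε → ∃ g ∈ generated F, tupleNorm (weakUnit ℝ F) (f - g) ≤ ε}
  zero_mem' := ⟨zero_mem _, fun ε hε => ⟨0, zero_mem _, by
    rw [sub_zero, tupleNorm_zero]; exact bot_le⟩⟩
  add_mem' := fun {f f'} hf hf' => ⟨add_mem hf.1 hf'.1, fun ε hε => by
    obtain ⟨g, hg, h⟩ := hf.2 (ε / 2) (ENNReal.half_pos hε.ne')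
    obtain ⟨g', hg', h'⟩ := hf'.2 (ε / 2) (ENNReal.half_pos hε.ne')
    refine ⟨g + g', add_mem hg hg', ?_⟩
    rw [add_sub_add_comm]
    exact (tupleNorm_add_le _ _).trans ((add_le_add h h').trans (ENNReal.add_halves ε).le)⟩
  smul_mem' := fun r f hf => ⟨(H1 F).smul_mem r hf.1, fun ε hε => by
    obtain ⟨g, hg, h⟩ := hf.2 (ε / ENNReal.ofReal |r|) (ENNReal.div_pos hε.ne' ENNReal.ofReal_ne_top)
    refine ⟨r • g, (generated F).smul_mem r hg, ?_⟩
    rw [← smul_sub]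
    exact (tupleNorm_smul_le r _).trans ((mul_le_mul_right h _).trans ENNReal.mul_div_le)⟩

variable {F}

theorem tupleNorm_eval_le (x : F) : tupleNorm (weakUnit ℝ F) (eval x) ≤ ENNReal.ofReal ‖x‖ := by
  refine tupleNorm_le fun a ha => ENNReal.ofReal_le_ofReal ?_
  rcases eq_or_ne x 0 with rfl | hx
  · simp [eval]
  have hx' : 0 < ‖x‖ := norm_pos_iff.2 hx
  have h := ha (‖x‖⁻¹ • x) (by rw [norm_smul, norm_inv, norm_norm, inv_mul_cancel₀ hx'.ne'])
  have h2 : ∑ j, ‖a.2 j (‖x‖⁻¹ • x)‖ = ‖x‖⁻¹ * ∑ j, |eval x (a.2 j)| := by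
    rw [Finset.mul_sum]
    simp [eval]
  rw [h2, inv_mul_le_iff₀ hx', mul_one] at h
  exact h

theorem eval_mem_generated (x : F) : eval x ∈ generated F :=
  Submodule.mem_sInf.2 fun _ hM => hM.1 x

theorem sup_mem_generated {f g : StrongDual ℝ F → ℝ} (hf : f ∈ generated F)
    (hg : g ∈ generated F) : f ⊔ g ∈ generated F :=
  Submodule.mem_sInf.2 fun M hM =>
    hM.2 f (Submodule.mem_sInf.1 hf M hM) g (Submodule.mem_sInf.1 hg M hM)

theorem eval_mem_FBL (x : F) : eval x ∈ FBL F :=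
  ⟨⟨fun c φ _ => by simp [eval], (tupleNorm_eval_le x).trans_lt ENNReal.ofReal_lt_top⟩,
    fun ε hε => ⟨eval x, eval_mem_generated x, by
      rw [sub_self, tupleNorm_zero]; exact bot_le⟩⟩

theorem sup_mem_FBL {f f' : StrongDual ℝ F → ℝ} (hf : f ∈ FBL F) (hf' : f' ∈ FBL F) :
    f ⊔ f' ∈ FBL F := by
  refine ⟨⟨fun c φ hc => ?_, ?_⟩, fun ε hε => ?_⟩
  · simp only [Pi.sup_apply, hf.1.1 c φ hc, hf'.1.1 c φ hc]
    exact (mul_max_of_nonneg _ _ hc).symm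
  · refine (tupleNorm_add_of_le (g := f) (h := f') fun w => ?_).trans_lt
      (ENNReal.add_lt_top.2 ⟨hf.1.2, hf'.1.2⟩)
    exact (abs_max_le_max_abs_abs).trans (max_le_add_of_nonneg (abs_nonneg _) (abs_nonneg _))
  · obtain ⟨g, hg, h⟩ := hf.2 (ε / 2) (ENNReal.half_pos hε.ne')
    obtain ⟨g', hg', h'⟩ := hf'.2 (ε / 2) (ENNReal.half_pos hε.ne')
    refine ⟨g ⊔ g', sup_mem_generated hg hg', ?_⟩
    refine (tupleNorm_add_of_le (g := f - g) (h := f' - g') fun w => ?_).trans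
      ((add_le_add h h').trans (ENNReal.add_halves ε).le)
    exact (abs_max_sub_max_le_max _ _ _ _).trans
      (max_le_add_of_nonneg (abs_nonneg _) (abs_nonneg _))

theorem inf_mem_FBL {f f' : StrongDual ℝ F → ℝ} (hf : f ∈ FBL F) (hf' : f' ∈ FBL F) :
    f ⊓ f' ∈ FBL F := by
  have h := neg_mem (sup_mem_FBL (neg_mem hf) (neg_mem hf'))
  rwa [neg_sup, neg_neg, neg_neg] at h

end Real

end FreeBL

/-- The real part of `FBL_ℂ[E]`: the set `FBL[E_ℝ]`, which is going to carry the norm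
`sup ∑ |f(Re zⱼ*)|`. -/
def FBLRe (E : Type*) [NormedAddCommGroup E] [NormedSpace ℂ E] : Type _ := FreeBL.FBL E

namespace FBLRe

open FreeBL

/-- An element of `FBL[E_ℝ]` as an element of the renormed copy. -/
def mk {E : Type*} [NormedAddCommGroup E] [NormedSpace ℂ E] (f : StrongDual ℝ E → ℝ)
    (hf : f ∈ FreeBL.FBL E) : FBLRe E := ⟨f, hf⟩

@[simp] theorem val_mk {E : Type*} [NormedAddCommGroup E] [NormedSpace ℂ E]
    (f : StrongDual ℝ E → ℝ) (hf : f ∈ FreeBL.FBL E) : (mk f hf).1 = f := rfl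

section Structure

variable {E : Type*} [NormedAddCommGroup E] [NormedSpace ℂ E]

/-- The real part of a complex functional. -/
noncomputable def rePart (ζ : StrongDual ℂ E) : StrongDual ℝ E :=
  Complex.reCLM.comp (ζ.restrictScalars ℝ)

@[simp] theorem rePart_apply (ζ : StrongDual ℂ E) (v : E) : rePart ζ v = (ζ v).re := rfl

/-- The norm `sup {∑ |f(Re zⱼ*)| : sup_{‖v‖ ≤ 1} ∑ |zⱼ*(v)| ≤ 1}`. -/
noncomputable def cNorm (f : StrongDual ℝ E → ℝ) : ℝ≥0∞ :=
  tupleNorm (weakUnit ℂ E) fun ζ => f (rePart ζ)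

/-- The complex functional `z ↦ φ(z) - i φ(iz)` with real part `φ`. -/
noncomputable def toComplex (φ : StrongDual ℝ E) : StrongDual ℂ E := φ.extendRCLike

theorem toComplex_apply (φ : StrongDual ℝ E) (v : E) :
    toComplex φ v = (φ v : ℂ) - Complex.I * (φ (Complex.I • v) : ℂ) :=
  StrongDual.extendRCLike_apply φ v

theorem rePart_toComplex (φ : StrongDual ℝ E) : rePart (toComplex φ) = φ := by
  ext v
  simp [toComplex_apply]

theorem cNorm_le (f : StrongDual ℝ E → ℝ) : cNorm f ≤ tupleNorm (weakUnit ℝ E) f := by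
  have := tupleNorm_le_mul (A := weakUnit ℂ E) (B := weakUnit ℝ E) (f := fun ζ => f (rePart ζ))
    (g := f) (c := 1) zero_le_one rePart
    (fun a ha v hv => (Finset.sum_le_sum fun j _ => by
      simpa using Complex.abs_re_le_norm (a.2 j v)).trans (ha v hv))
    (fun w => by simp)
  rwa [ENNReal.ofReal_one, one_mul] at this

theorem le_cNorm {f : StrongDual ℝ E → ℝ}
    (hf : ∀ (c : ℝ) (φ : StrongDual ℝ E), 0 ≤ c → f (c • φ) = c * f φ) :
    tupleNorm (weakUnit ℝ E) f ≤ 2 * cNorm f := by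
  have := tupleNorm_le_mul (A := weakUnit ℝ E) (B := weakUnit ℂ E) (f := f)
    (g := fun ζ => f (rePart ζ)) (c := 2) zero_le_two
    (fun φ => toComplex ((2⁻¹ : ℝ) • φ))
    (fun a ha v hv => by
      have h1 := ha v hv
      have h2 := ha (Complex.I • v) (by simpa [norm_smul] using hv)
      have h3 : ∀ j, ‖toComplex ((2⁻¹ : ℝ) • a.2 j) v‖ ≤
          2⁻¹ * (‖a.2 j v‖ + ‖a.2 j (Complex.I • v)‖) := by
        intro j
        rw [toComplex_apply]
        refine (norm_sub_le _ _).trans (le_of_eq ?_)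
        simp
        ring
      refine (Finset.sum_le_sum fun j _ => h3 j).trans ?_
      rw [← Finset.mul_sum, Finset.sum_add_distrib]
      linarith)
    (fun w => by
      rw [rePart_toComplex, hf _ _ (by norm_num), abs_mul, abs_of_pos (by norm_num : (0 : ℝ) < 2⁻¹)]
      exact le_of_eq (by ring))
  have h2 : ENNReal.ofReal 2 = 2 := by simp
  rwa [h2] at this

theorem cNorm_lt_top (f : FBLRe E) : cNorm f.1 < ⊤ := (cNorm_le f.1).trans_lt f.2.1.2

noncomputable instance : AddCommGroup (FBLRe E) := inferInstanceAs (AddCommGroup (FreeBL.FBL E))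

noncomputable instance : Module ℝ (FBLRe E) := inferInstanceAs (Module ℝ (FreeBL.FBL E))

@[ext] theorem ext {f g : FBLRe E} (h : ∀ φ, f.1 φ = g.1 φ) : f = g := Subtype.ext (funext h)

@[simp] theorem val_zero : (0 : FBLRe E).1 = 0 := rfl
@[simp] theorem val_add (f g : FBLRe E) : (f + g).1 = f.1 + g.1 := rfl
@[simp] theorem val_neg (f : FBLRe E) : (-f).1 = -f.1 := rfl
@[simp] theorem val_sub (f g : FBLRe E) : (f - g).1 = f.1 - g.1 := rfl
@[simp] theorem val_smul (c : ℝ) (f : FBLRe E) : (c • f).1 = c • f.1 := rfl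

/-- The order and the lattice operations are pointwise. -/
noncomputable instance : Lattice (FBLRe E) where
  le f g := f.1 ≤ g.1
  le_refl f := le_refl f.1
  le_trans _ _ _ h h' := le_trans (α := StrongDual ℝ E → ℝ) h h'
  le_antisymm _ _ h h' := Subtype.ext (le_antisymm h h')
  sup f g := ⟨f.1 ⊔ g.1, sup_mem_FBL f.2 g.2⟩
  inf f g := ⟨f.1 ⊓ g.1, inf_mem_FBL f.2 g.2⟩
  le_sup_left f g := le_sup_left (a := f.1) (b := g.1)
  le_sup_right f g := le_sup_right (a := f.1) (b := g.1)
  sup_le _ _ _ h h' := sup_le (α := StrongDual ℝ E → ℝ) h h'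
  inf_le_left f g := inf_le_left (a := f.1) (b := g.1)
  inf_le_right f g := inf_le_right (a := f.1) (b := g.1)
  le_inf _ _ _ h h' := le_inf (α := StrongDual ℝ E → ℝ) h h'

theorem le_def {f g : FBLRe E} : f ≤ g ↔ ∀ φ, f.1 φ ≤ g.1 φ := Iff.rfl
@[simp] theorem val_sup (f g : FBLRe E) : (f ⊔ g).1 = f.1 ⊔ g.1 := rfl
@[simp] theorem val_inf (f g : FBLRe E) : (f ⊓ g).1 = f.1 ⊓ g.1 := rfl
theorem val_abs (f : FBLRe E) (φ : StrongDual ℝ E) : (|f|).1 φ = |f.1 φ| := rfl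

instance : IsOrderedAddMonoid (FBLRe E) where
  add_le_add_left f g h k := fun φ => by
    simpa using h φ

instance : IsOrderedModule ℝ (FBLRe E) where
  smul_le_smul_of_nonneg_left c hc f g h := fun φ => mul_le_mul_of_nonneg_left (h φ) hc
  smul_le_smul_of_nonneg_right f hf c d h := fun φ => mul_le_mul_of_nonneg_right h (hf φ)

/-- Evaluation at a point is bounded for the norm `cNorm`. -/
theorem exists_abs_le (φ : StrongDual ℝ E) : ∃ c : ℝ, 0 ≤ c ∧ ∀ f ∈ FreeBL.FBL E,
    |f φ| ≤ c * (cNorm f).toReal := by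
  set c : ℝ := ‖toComplex φ‖ + 1 with hc
  have hc0 : 0 < c := by positivity
  refine ⟨c, hc0.le, fun f hf => ?_⟩
  have hmem : (⟨1, fun _ => toComplex (c⁻¹ • φ)⟩ : Σ n : ℕ, Fin n → StrongDual ℂ E) ∈
      weakUnit ℂ E := by
    intro v hv
    have h1 : toComplex (c⁻¹ • φ) v = (c⁻¹ : ℂ) * toComplex φ v := by
      rw [toComplex_apply, toComplex_apply]
      simp
      ring
    have h2 : ‖toComplex φ v‖ ≤ c := by
      refine ((toComplex φ).le_opNorm v).trans ?_
      nlinarith [norm_nonneg (toComplex φ), norm_nonneg v]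
    simp only [Finset.univ_unique, Finset.sum_const, Finset.card_singleton, one_smul, h1]
    rw [norm_mul, norm_inv, Complex.norm_real, Real.norm_of_nonneg hc0.le,
      inv_mul_le_iff₀ hc0, mul_one]
    exact h2
  have h := le_tupleNorm hmem (fun ζ => f (rePart ζ))
  have h3 : |f (c⁻¹ • φ)| ≤ (cNorm f).toReal := by
    have hfin : cNorm f ≠ ⊤ := (cNorm_lt_top ⟨f, hf⟩).ne
    have := (ENNReal.ofReal_le_iff_le_toReal hfin).1 h
    simpa [rePart_toComplex] using this
  rw [hf.1.1 _ _ (inv_nonneg.2 hc0.le), abs_mul, abs_inv, abs_of_pos hc0,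
    inv_mul_le_iff₀ hc0] at h3
  exact h3

noncomputable instance : Norm (FBLRe E) := ⟨fun f => (cNorm f.1).toReal⟩

theorem norm_def (f : FBLRe E) : ‖f‖ = (cNorm f.1).toReal := rfl

theorem cNorm_neg (f : StrongDual ℝ E → ℝ) : cNorm (-f) = cNorm f :=
  le_antisymm (tupleNorm_mono fun _ => by simp) (tupleNorm_mono fun _ => by simp)

noncomputable instance : NormedAddCommGroup (FBLRe E) :=
  AddGroupNorm.toNormedAddCommGroup
    { toFun := fun f => (cNorm f.1).toReal
      map_zero' := by
        have : cNorm (0 : StrongDual ℝ E → ℝ) = 0 := tupleNorm_zero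
        simp [this]
      add_le' := fun f g => by
        rw [← ENNReal.toReal_add (cNorm_lt_top f).ne (cNorm_lt_top g).ne]
        exact ENNReal.toReal_mono (ENNReal.add_lt_top.2 ⟨cNorm_lt_top f, cNorm_lt_top g⟩).ne
          (tupleNorm_add_le _ _)
      neg' := fun f => by rw [val_neg, cNorm_neg]
      eq_zero_of_map_eq_zero' := fun f h => by
        ext φ
        obtain ⟨c, _, hc⟩ := exists_abs_le φ
        have := hc f.1 f.2
        rw [h, mul_zero] at this
        simpa using this }

noncomputable instance : NormedSpace ℝ (FBLRe E) where
  norm_smul_le c f := by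
    rw [norm_def, norm_def, Real.norm_eq_abs, ← ENNReal.toReal_ofReal (abs_nonneg c),
      ← ENNReal.toReal_mul]
    exact ENNReal.toReal_mono (ENNReal.mul_lt_top ENNReal.ofReal_lt_top (cNorm_lt_top f)).ne
      (tupleNorm_smul_le c _)

instance : HasSolidNorm (FBLRe E) where
  solid f g h := ENNReal.toReal_mono (cNorm_lt_top g).ne (tupleNorm_mono fun ζ => h (rePart ζ))

instance : CompleteSpace (FBLRe E) := by
  refine Metric.complete_of_cauchySeq_tendsto fun u hu => ?_
  have hpt : ∀ φ : StrongDual ℝ E, ∃ t, Tendsto (fun n => (u n).1 φ) atTop (𝓝 t) := by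
    intro φ
    obtain ⟨c, hc0, hc⟩ := exists_abs_le φ
    refine cauchySeq_tendsto_of_complete ?_
    rw [Metric.cauchySeq_iff] at hu ⊢
    intro ε hε
    obtain ⟨N, hN⟩ := hu (ε / (c + 1)) (by positivity)
    refine ⟨N, fun m hm n hn => ?_⟩
    have h1 := hN m hm n hn
    rw [dist_eq_norm, lt_div_iff₀ (by positivity)] at h1
    have h2 : |(u m).1 φ - (u n).1 φ| ≤ c * ‖u m - u n‖ := hc _ (u m - u n).2
    rw [Real.dist_eq]
    nlinarith [norm_nonneg (u m - u n)]
  choose f hf using hpt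
  have hhom : ∀ (c : ℝ) (φ : StrongDual ℝ E), 0 ≤ c → f (c • φ) = c * f φ := by
    intro c φ hc
    refine tendsto_nhds_unique (hf (c • φ)) ?_
    have : (fun n => (u n).1 (c • φ)) = fun n => c * (u n).1 φ :=
      funext fun n => (u n).2.1.1 c φ hc
    rw [this]
    exact (hf φ).const_mul c
  have hlim : ∀ ε : ℝ, 0 < ε → ∃ N, ∀ n ≥ N, cNorm (f - (u n).1) ≤ ENNReal.ofReal ε := by
    intro ε hε
    obtain ⟨N, hN⟩ := Metric.cauchySeq_iff.1 hu ε hε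
    refine ⟨N, fun n hn => tupleNorm_le fun a ha => ENNReal.ofReal_le_ofReal ?_⟩
    have ht : Tendsto (fun m => ∑ j, |((u m).1 - (u n).1) (rePart (a.2 j))|) atTop
        (𝓝 (∑ j, |(f - (u n).1) (rePart (a.2 j))|)) :=
      tendsto_finsetSum _ fun j _ => ((hf _).sub_const _).abs
    refine le_of_tendsto ht (eventually_atTop.2 ⟨N, fun m hm => ?_⟩)
    have h1 := hN m hm n hn
    rw [dist_eq_norm] at h1
    have h2 := le_tupleNorm ha (fun ζ => ((u m).1 - (u n).1) (rePart ζ))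
    exact ((ENNReal.ofReal_le_iff_le_toReal (cNorm_lt_top (u m - u n)).ne).1 h2).trans h1.le
  have hreal : ∀ n, tupleNorm (weakUnit ℝ E) (f - (u n).1) ≤ 2 * cNorm (f - (u n).1) := fun n =>
    le_cNorm fun c φ hc => by
      simp only [Pi.sub_apply, hhom c φ hc, (u n).2.1.1 c φ hc]
      ring
  have hmem : f ∈ FreeBL.FBL E := by
    refine ⟨⟨hhom, ?_⟩, fun ε hε => ?_⟩
    · obtain ⟨N, hN⟩ := hlim 1 one_pos
      have h1 : tupleNorm (weakUnit ℝ E) (f - (u N).1) < ⊤ :=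
        ((hreal N).trans (mul_le_mul_right (hN N le_rfl) 2)).trans_lt
          (ENNReal.mul_lt_top (by simp) ENNReal.ofReal_lt_top)
      have h2 := tupleNorm_add_le (A := weakUnit ℝ E) (f - (u N).1) (u N).1
      rw [sub_add_cancel] at h2
      exact h2.trans_lt (ENNReal.add_lt_top.2 ⟨h1, (u N).2.1.2⟩)
    · obtain ⟨δ, hδ0, hδ⟩ : ∃ δ : ℝ, 0 < δ ∧ 2 * ENNReal.ofReal δ ≤ ε / 2 := by
        rcases eq_or_ne ε ⊤ with rfl | hε'
        · exact ⟨1, one_pos, by simp [ENNReal.top_div]⟩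
        · refine ⟨ε.toReal / 4, by have := ENNReal.toReal_pos hε.ne' hε'; positivity, ?_⟩
          rw [ENNReal.ofReal_div_of_pos (by norm_num), ENNReal.ofReal_toReal hε']
          have : (2 : ℝ≥0∞) * (ε / ENNReal.ofReal 4) = ε / 2 := by
            have h4 : ENNReal.ofReal 4 = 2 * 2 := by
              rw [show (4 : ℝ) = 2 * 2 by norm_num, ENNReal.ofReal_mul (by norm_num)]
              simp
            rw [h4, ← mul_div_assoc]
            exact ENNReal.mul_div_mul_left _ _ (by simp) (by simp)
          rw [this]
      obtain ⟨N, hN⟩ := hlim δ hδ0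
      obtain ⟨g, hg, h⟩ := (u N).2.2 (ε / 2) (ENNReal.half_pos hε.ne')
      refine ⟨g, hg, ?_⟩
      have h1 := tupleNorm_add_le (A := weakUnit ℝ E) (f - (u N).1) ((u N).1 - g)
      rw [sub_add_sub_cancel] at h1
      refine h1.trans ((add_le_add (((hreal N).trans (mul_le_mul_right (hN N le_rfl) 2)).trans hδ)
        h).trans (ENNReal.add_halves ε).le)
  let F : FBLRe E := mk f hmem
  refine ⟨F, Metric.tendsto_atTop.2 ?_⟩
  intro ε hε
  obtain ⟨N, hN⟩ := hlim (ε / 2) (by positivity)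
  refine ⟨N, fun n hn => ?_⟩
  rw [dist_comm, dist_eq_norm]
  have h1 : ‖F - u n‖ ≤ ε / 2 := by
    have h2 := ENNReal.toReal_mono ENNReal.ofReal_ne_top (hN n hn)
    rw [ENNReal.toReal_ofReal (by positivity)] at h2
    exact h2
  linarith

/-- The real evaluation map `δ_{E_ℝ}`. -/
noncomputable def deltaRe (x : E) : FBLRe E := mk (eval x) (eval_mem_FBL x)

@[simp] theorem deltaRe_apply (x : E) (φ : StrongDual ℝ E) : (deltaRe x).1 φ = φ x := rfl

theorem norm_deltaRe_le (x : E) : ‖deltaRe x‖ ≤ ‖x‖ := by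
  have h := ENNReal.toReal_mono ENNReal.ofReal_ne_top ((cNorm_le _).trans (tupleNorm_eval_le x))
  rwa [ENNReal.toReal_ofReal (norm_nonneg x)] at h

end Structure

section Functorial

variable {E : Type*} [NormedAddCommGroup E] [NormedSpace ℂ E]
variable {G : Type*} [NormedAddCommGroup G] [NormedSpace ℂ G]

theorem generated_le : generated E ≤ FreeBL.FBL E :=
  sInf_le ⟨eval_mem_FBL, fun _ hf _ hg => sup_mem_FBL hf hg⟩

theorem hom_of_mem {f : StrongDual ℝ E → ℝ} (hf : f ∈ FreeBL.FBL E) (c : ℝ) (φ : StrongDual ℝ E)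
    (hc : 0 ≤ c) : f (c • φ) = c * f φ := hf.1.1 c φ hc

/-- Composition with the adjoint of `T`, on functions. -/
noncomputable def compFun (T : E →L[ℂ] G) : (StrongDual ℝ E → ℝ) →ₗ[ℝ] (StrongDual ℝ G → ℝ) :=
  LinearMap.funLeft ℝ ℝ fun φ => φ.comp (T.restrictScalars ℝ)

@[simp] theorem compFun_apply (T : E →L[ℂ] G) (f : StrongDual ℝ E → ℝ) (φ : StrongDual ℝ G) :
    compFun T f φ = f (φ.comp (T.restrictScalars ℝ)) := rfl

theorem norm_inv_smul_le (T : E →L[ℂ] G) {v : E} (hv : ‖v‖ ≤ 1) :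
    ‖(‖T‖ + 1)⁻¹ • T v‖ ≤ 1 := by
  have hc : 0 < ‖T‖ + 1 := by positivity
  rw [norm_smul, norm_inv, Real.norm_of_nonneg hc.le, inv_mul_le_iff₀ hc, mul_one]
  refine (T.le_opNorm v).trans ?_
  nlinarith [norm_nonneg T, norm_nonneg v]

theorem tupleNorm_compFun_le (T : E →L[ℂ] G) {f : StrongDual ℝ E → ℝ}
    (hf : ∀ (c : ℝ) (φ : StrongDual ℝ E), 0 ≤ c → f (c • φ) = c * f φ) :
    tupleNorm (weakUnit ℝ G) (compFun T f) ≤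
      ENNReal.ofReal (‖T‖ + 1) * tupleNorm (weakUnit ℝ E) f := by
  have hc : 0 < ‖T‖ + 1 := by positivity
  refine tupleNorm_le_mul hc.le (fun φ => (‖T‖ + 1)⁻¹ • φ.comp (T.restrictScalars ℝ)) ?_ ?_
  · intro a ha v hv
    refine le_trans (le_of_eq ?_) (ha _ (norm_inv_smul_le T hv))
    simp
  · intro φ
    rw [hf _ _ (inv_nonneg.2 hc.le), abs_mul, abs_inv, abs_of_pos hc, mul_inv_cancel_left₀ hc.ne']
    exact le_rfl

theorem cNorm_compFun_le (T : E →L[ℂ] G) {f : StrongDual ℝ E → ℝ}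
    (hf : ∀ (c : ℝ) (φ : StrongDual ℝ E), 0 ≤ c → f (c • φ) = c * f φ) :
    cNorm (compFun T f) ≤ ENNReal.ofReal (‖T‖ + 1) * cNorm f := by
  have hc : 0 < ‖T‖ + 1 := by positivity
  have hre : ∀ (r : ℝ) (v : G) (ζ : StrongDual ℂ G), ζ (r • v) = r • ζ v := fun r v ζ =>
    (ζ.restrictScalars ℝ).map_smul r v
  refine tupleNorm_le_mul hc.le (fun ζ => ((‖T‖ + 1 : ℝ)⁻¹ : ℂ) • ζ.comp T) ?_ ?_
  · intro a ha v hv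
    refine le_trans (le_of_eq ?_) (ha _ (norm_inv_smul_le T hv))
    refine Finset.sum_congr rfl fun j _ => ?_
    rw [hre, ← Complex.ofReal_inv]
    simp
  · intro ζ
    have h1 : rePart (((‖T‖ + 1 : ℝ)⁻¹ : ℂ) • ζ.comp T) =
        (‖T‖ + 1)⁻¹ • (rePart ζ).comp (T.restrictScalars ℝ) := by
      ext v
      rw [← Complex.ofReal_inv]
      simp only [rePart_apply, _root_.smul_apply, smul_eq_mul, Complex.re_ofReal_mul]
      rfl
    rw [h1, hf _ _ (inv_nonneg.2 hc.le), abs_mul, abs_inv, abs_of_pos hc,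
      mul_inv_cancel_left₀ hc.ne']
    exact le_rfl

theorem compFun_mem_generated (T : E →L[ℂ] G) {f : StrongDual ℝ E → ℝ} (hf : f ∈ generated E) :
    compFun T f ∈ generated G := by
  have : generated E ≤ (generated G).comap (compFun T) :=
    sInf_le ⟨fun x => eval_mem_generated (T x), fun _ hf _ hg => sup_mem_generated hf hg⟩
  exact this hf

theorem compFun_mem_FBL (T : E →L[ℂ] G) {f : StrongDual ℝ E → ℝ} (hf : f ∈ FreeBL.FBL E) :
    compFun T f ∈ FreeBL.FBL G := by
  have hc : 0 < ‖T‖ + 1 := by positivity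
  refine ⟨⟨fun c φ hc => ?_, ?_⟩, fun ε hε => ?_⟩
  · simp only [compFun_apply, ContinuousLinearMap.smul_comp, hf.1.1 c _ hc]
  · exact (tupleNorm_compFun_le T hf.1.1).trans_lt
      (ENNReal.mul_lt_top ENNReal.ofReal_lt_top hf.1.2)
  · obtain ⟨g, hg, h⟩ := hf.2 (ε / ENNReal.ofReal (‖T‖ + 1))
      (ENNReal.div_pos hε.ne' ENNReal.ofReal_ne_top)
    refine ⟨compFun T g, compFun_mem_generated T hg, ?_⟩
    rw [← map_sub]
    exact (tupleNorm_compFun_le T (hom_of_mem (sub_mem hf (generated_le hg)))).trans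
      ((mul_le_mul_right h _).trans ENNReal.mul_div_le)

/-- The real lattice homomorphism `f ↦ f ∘ T*`. -/
noncomputable def compRe (T : E →L[ℂ] G) : FBLRe E →L[ℝ] FBLRe G :=
  LinearMap.mkContinuous
    { toFun := fun f => mk (compFun T f.1) (compFun_mem_FBL T f.2)
      map_add' := fun _ _ => rfl
      map_smul' := fun _ _ => rfl }
    (‖T‖ + 1) (fun f => by
      have h := ENNReal.toReal_mono
        (ENNReal.mul_lt_top ENNReal.ofReal_lt_top (cNorm_lt_top f)).ne
        (cNorm_compFun_le T f.2.1.1)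
      rw [ENNReal.toReal_mul, ENNReal.toReal_ofReal (by positivity)] at h
      exact h)

/-- Real lattice homomorphisms on `FBL[E_ℝ]` are determined by their values on evaluations. -/
theorem hom_ext {S S' : FBLRe E →L[ℝ] FBLRe G} (hS : ∀ f g, S (f ⊔ g) = S f ⊔ S g)
    (hS' : ∀ f g, S' (f ⊔ g) = S' f ⊔ S' g) (h : ∀ x, S (deltaRe x) = S' (deltaRe x)) :
    S = S' := by
  have hgen : ∀ f (hf : f ∈ generated E), ∃ hf' : f ∈ FreeBL.FBL E,
      S (mk f hf') = S' (mk f hf') := by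
    let M : Submodule ℝ (StrongDual ℝ E → ℝ) :=
      { carrier := {f | ∃ hf' : f ∈ FreeBL.FBL E,
          S (mk f hf') = S' (mk f hf')}
        zero_mem' := ⟨zero_mem _, (map_zero S).trans (map_zero S').symm⟩
        add_mem' := fun {f g} hf hg => by
          obtain ⟨hf, h1⟩ := hf
          obtain ⟨hg, h2⟩ := hg
          refine ⟨add_mem hf hg, ?_⟩
          have e1 := map_add S (mk f hf) (mk g hg)
          have e2 := map_add S' (mk f hf) (mk g hg)
          rw [h1, h2] at e1
          exact e1.trans e2.symm
        smul_mem' := fun c f hf => by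
          obtain ⟨hf, h1⟩ := hf
          refine ⟨Submodule.smul_mem _ c hf, ?_⟩
          have e1 := map_smul S c (mk f hf)
          have e2 := map_smul S' c (mk f hf)
          rw [h1] at e1
          exact e1.trans e2.symm }
    have hM : generated E ≤ M := sInf_le ⟨fun x => ⟨eval_mem_FBL x, h x⟩, by
      rintro f ⟨hf, h1⟩ g ⟨hg, h2⟩
      refine ⟨sup_mem_FBL hf hg, ?_⟩
      have e1 := hS (mk f hf) (mk g hg)
      have e2 := hS' (mk f hf) (mk g hg)
      rw [h1, h2] at e1
      exact e1.trans e2.symm⟩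
    exact fun f hf => hM hf
  refine ContinuousLinearMap.ext fun f => ?_
  have hcl : f ∈ closure {g : FBLRe E | S g = S' g} := by
    refine Metric.mem_closure_iff.2 fun ε hε => ?_
    obtain ⟨g, hg, hfg⟩ := f.2.2 (ENNReal.ofReal (ε / 2)) (by simpa using hε)
    obtain ⟨hg', hgS⟩ := hgen g hg
    let g' : FBLRe E := mk g hg'
    refine ⟨g', hgS, ?_⟩
    rw [dist_eq_norm]
    have h2 := ENNReal.toReal_mono ENNReal.ofReal_ne_top ((cNorm_le (f.1 - g)).trans hfg)
    rw [ENNReal.toReal_ofReal (by positivity)] at h2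
    have h3 : ‖f - g'‖ ≤ ε / 2 := h2
    linarith
  exact (isClosed_eq S.continuous S'.continuous).closure_subset hcl

end Functorial

end FBLRe

section FBLC

variable {E : Type*} [NormedAddCommGroup E] [NormedSpace ℂ E]
variable {G : Type*} [NormedAddCommGroup G] [NormedSpace ℂ G]

/-- The free complex Banach lattice `FBL_ℂ[E]` generated by the complex Banach space `E`. -/
abbrev FBLC (E : Type*) [NormedAddCommGroup E] [NormedSpace ℂ E] : Type _ := Cplx (FBLRe E)

/-- The canonical embedding `δ_E(z) = δ_{E_ℝ}(z) - i δ_{E_ℝ}(iz)`. -/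
noncomputable def deltaC : E →L[ℂ] FBLC E :=
  LinearMap.mkContinuous
    { toFun := fun z => ⟨FBLRe.deltaRe z, -FBLRe.deltaRe (Complex.I • z)⟩
      map_add' := fun z w => by
        ext φ <;> simp [add_comm]
      map_smul' := fun c z => by
        have key : ∀ (φ : StrongDual ℝ E) (d : ℂ) (v : E),
            φ (d • v) = d.re * φ v + d.im * φ (Complex.I • v) := by
          intro φ d v
          have : d • v = d.re • v + d.im • (Complex.I • v) := by
            conv_lhs => rw [← Complex.re_add_im d, add_smul, mul_smul]
            rfl
          rw [this, map_add, map_smul, map_smul, smul_eq_mul, smul_eq_mul]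
        ext φ
        · simp [key φ c z]
        · have : Complex.I • c • z = (Complex.I * c) • z := (mul_smul _ _ _).symm
          simp [this, key φ (Complex.I * c) z]
          ring }
    2 (fun z => by
      refine (Cplx.norm_le_add _).trans ?_
      have h1 := FBLRe.norm_deltaRe_le z
      have h2 := FBLRe.norm_deltaRe_le (Complex.I • z)
      rw [norm_smul, Complex.norm_I, one_mul] at h2
      simp only [LinearMap.coe_mk, AddHom.coe_mk, norm_neg]
      linarith)

theorem deltaC_apply (z : E) :
    deltaC z = ⟨FBLRe.deltaRe z, -FBLRe.deltaRe (Complex.I • z)⟩ := rfl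

theorem existsUnique_inducedHom (T : E →L[ℂ] G) :
    ∃! S : FBLC E →L[ℂ] FBLC G, Cplx.IsLatticeHom S ∧ ∀ z, S (deltaC z) = deltaC (T z) := by
  refine ⟨Cplx.map (FBLRe.compRe T), ⟨⟨_, fun _ _ => rfl, fun _ _ => rfl, rfl⟩, fun z => ?_⟩, ?_⟩
  · rw [deltaC_apply, deltaC_apply, ← map_smul T]
    rfl
  · rintro _ ⟨⟨S, hS, -, rfl⟩, h⟩
    congr 1
    refine FBLRe.hom_ext hS (fun _ _ => rfl) fun x => ?_
    exact congrArg Cplx.re (h x)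

/-- The operator `T̄`: the unique lattice homomorphism `FBL_ℂ[E] → FBL_ℂ[G]` such that
`T̄ ∘ δ_E = δ_G ∘ T`. -/
noncomputable def inducedHom (T : E →L[ℂ] G) : FBLC E →L[ℂ] FBLC G :=
  (existsUnique_inducedHom T).choose

theorem isLatticeHom_inducedHom (T : E →L[ℂ] G) : Cplx.IsLatticeHom (inducedHom T) :=
  (existsUnique_inducedHom T).choose_spec.1.1

theorem inducedHom_deltaC (T : E →L[ℂ] G) (z : E) : inducedHom T (deltaC z) = deltaC (T z) :=
  (existsUnique_inducedHom T).choose_spec.1.2 z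

end FBLC

/-!
The proof rests on a retraction: a Banach lattice `X` is free over itself in the sense that the
identity of `X_ℂ` extends to a lattice homomorphism `β : FBL_ℂ[X_ℂ] → X_ℂ` with `β ∘ δ = id`. If `T`
is a lattice homomorphism, then `β ∘ T̄` and `T ∘ β` are lattice homomorphisms which agree on the
range of `δ`, so they are equal, and `β (λ - T̄)⁻¹ δ` is an inverse of `λ - T` whenever `λ - T̄` is
invertible.

To extend a real operator `T : E → X` to `FBL[E_ℝ]`, one has to bound a lattice expression in the
vectors `T z` by the norm of the same expression in the functions `δ_z`. Up to absolute values, the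
norm of the former is its value under some positive functional `φ` of norm at most one, and every
lattice expression is a difference of finite suprema. By the Hahn-Banach theorem `φ` splits at each
supremum into positive functionals `φ₁ + φ₂ = φ` with `φ (x ⊔ y) = φ₁ x + φ₂ y`. Iterating this
decomposes `φ` into positive `ψ₁, …, ψₙ` such that `φ` of the expression in the `T z` is at most the
sum of the values at `ψₖ ∘ T` of the expression in the `δ_z`. Since
`∑ |ψₖ (T v)| ≤ φ |T v| ≤ ‖T‖ ‖v‖`, the tuple `ψₖ ∘ T` is, up to the factor `2 ‖T‖`, admissible in
the supremum which defines the free norm.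
-/

section Retraction

variable {𝕜 E F : Type*} [NontriviallyNormedField 𝕜] [NormedAddCommGroup E] [NormedSpace 𝕜 E]
  [NormedAddCommGroup F] [NormedSpace 𝕜 F]

theorem isUnit_of_retraction {S : E →L[𝕜] E} {T : F →L[𝕜] F} (δ : F →L[𝕜] E) (β : E →L[𝕜] F)
    (hβδ : β ∘L δ = .id 𝕜 F) (hδ : S ∘L δ = δ ∘L T) (hβ : β ∘L S = T ∘L β) (hS : IsUnit S) :
    IsUnit T := by
  obtain ⟨R, hSR, hRS⟩ := isUnit_iff_exists.1 hS
  refine isUnit_iff_exists.2 ⟨β ∘L R ∘L δ, ?_, ?_⟩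
  · calc T ∘L β ∘L R ∘L δ = β ∘L (S * R) ∘L δ := by
          rw [← ContinuousLinearMap.comp_assoc, ← hβ]; rfl
      _ = 1 := by rw [hSR]; exact hβδ
  · calc (β ∘L R ∘L δ) ∘L T = β ∘L (R * S) ∘L δ := by
          rw [ContinuousLinearMap.comp_assoc, ContinuousLinearMap.comp_assoc, ← hδ]; rfl
      _ = 1 := by rw [hRS]; exact hβδ

theorem spectrum_subset_of_retraction {S : E →L[𝕜] E} {T : F →L[𝕜] F} (δ : F →L[𝕜] E)
    (β : E →L[𝕜] F) (hβδ : β ∘L δ = .id 𝕜 F) (hδ : S ∘L δ = δ ∘L T) (hβ : β ∘L S = T ∘L β) :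
    spectrum 𝕜 T ⊆ spectrum 𝕜 S := by
  refine fun μ => mt fun hμ => isUnit_of_retraction δ β hβδ ?_ ?_ hμ
  · ext z
    simpa [Algebra.algebraMap_eq_smul_one] using DFunLike.congr_fun hδ z
  · ext f
    simpa [Algebra.algebraMap_eq_smul_one] using DFunLike.congr_fun hβ f

end Retraction

theorem exists_linearMap_le_eq {V : Type*} [AddCommGroup V] [Module ℝ V] {N : V → ℝ}
    (hsmul : ∀ c : ℝ, 0 < c → ∀ x, N (c • x) = c * N x) (hadd : ∀ x y, N (x + y) ≤ N x + N y)
    (x : V) : ∃ g : V →ₗ[ℝ] ℝ, g x = N x ∧ ∀ y, g y ≤ N y := by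
  have hzero : N 0 = 0 := by
    have h := hsmul 2 two_pos 0
    rw [smul_zero] at h
    linarith
  have hker : ∀ c : ℝ, c • x = 0 → c • N x = 0 := fun c hc => by
    rcases smul_eq_zero.1 hc with rfl | rfl
    · exact zero_smul ℝ _
    · rw [hzero, smul_zero]
  have hspan : ∀ c : ℝ, c * N x ≤ N (c • x) := fun c => by
    rcases lt_trichotomy c 0 with hc | rfl | hc
    · have h := hadd (c • x) (-c • x)
      rw [neg_smul, add_neg_cancel, hzero, ← neg_smul, hsmul (-c) (neg_pos.2 hc)] at h
      linarith
    · rw [zero_mul, zero_smul, hzero]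
    · exact (hsmul c hc x).ge
  obtain ⟨g, hg, hle⟩ := exists_extension_of_le_sublinear
    (LinearPMap.mkSpanSingleton' (R := ℝ) x (N x) hker) N hsmul hadd (by
      rintro ⟨y, hy⟩
      obtain ⟨c, rfl⟩ := Submodule.mem_span_singleton.1 hy
      exact (LinearPMap.mkSpanSingleton'_apply x (N x) hker c hy).trans_le (hspan c))
  refine ⟨g, ?_, hle⟩
  rw [hg ⟨x, Submodule.mem_span_singleton_self x⟩]
  exact LinearPMap.mkSpanSingleton'_apply_self x (N x) hker _

section LatticeOrderedGroup

theorem abs_map_le_of_monotone {L F : Type*} [AddCommGroup L] [Lattice L] [FunLike F L ℝ]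
    [AddMonoidHomClass F L ℝ] {φ : F}
    (hφ : Monotone φ) (a : L) : |φ a| ≤ φ |a| :=
  abs_le'.2 ⟨hφ (le_abs_self a), (map_neg φ a).ge.trans (hφ (neg_le_abs a))⟩

variable {L : Type*} [AddCommGroup L] [Lattice L] [IsOrderedAddMonoid L]

theorem sub_sup_sub_eq (a b c d : L) : (a - b) ⊔ (c - d) = ((a + d) ⊔ (c + b)) - (b + d) := by
  rw [sup_sub]
  congr 1 <;> abel

theorem add_posPart_le (a b : L) : (a + b)⁺ ≤ a⁺ + b⁺ :=
  sup_le (add_le_add (le_posPart a) (le_posPart b))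
    (add_nonneg (posPart_nonneg a) (posPart_nonneg b))

theorem map_inf_of_map_sup {M F : Type*} [AddCommGroup M] [Lattice M] [IsOrderedAddMonoid M]
    [FunLike F L M] [AddMonoidHomClass F L M] {S : F} (hS : ∀ a b, S (a ⊔ b) = S a ⊔ S b)
    (a b : L) : S (a ⊓ b) = S a ⊓ S b := by
  have h := congrArg Neg.neg (hS (-a) (-b))
  rwa [← neg_inf, map_neg, map_neg, map_neg, ← neg_inf, neg_neg, neg_neg] at h

end LatticeOrderedGroup

section VectorLattice

variable {L : Type*} [AddCommGroup L] [Module ℝ L] [Lattice L]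

theorem smul_sup_of_pos [IsOrderedModule ℝ L] {c : ℝ} (hc : 0 < c) (a b : L) :
    c • (a ⊔ b) = c • a ⊔ c • b :=
  (OrderIso.smulRight hc).map_sup a b

theorem smul_posPart_of_pos [IsOrderedModule ℝ L] {c : ℝ} (hc : 0 < c) (a : L) :
    (c • a)⁺ = c • a⁺ := by
  rw [posPart_def, posPart_def, smul_sup_of_pos hc, smul_zero]

theorem smul_mem_supClosure [IsOrderedModule ℝ L] (V : Submodule ℝ L) {c : ℝ} (hc : 0 ≤ c)
    {a : L} (ha : a ∈ supClosure (V : Set L)) : c • a ∈ supClosure (V : Set L) := by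
  rcases hc.eq_or_lt with rfl | hc
  · rw [zero_smul]
    exact subset_supClosure V.zero_mem
  · refine supClosure_min (t := {a | c • a ∈ supClosure (V : Set L)})
      (fun v hv => subset_supClosure (V.smul_mem c hv)) (fun a ha b hb => ?_) ha
    rw [Set.mem_ofPred_eq, smul_sup_of_pos hc]
    exact supClosed_supClosure ha hb

variable [IsOrderedAddMonoid L]

theorem add_mem_supClosure (V : Submodule ℝ L) {a b : L} (ha : a ∈ supClosure (V : Set L))
    (hb : b ∈ supClosure (V : Set L)) : a + b ∈ supClosure (V : Set L) := by
  have hadd : ∀ u ∈ V, u + b ∈ supClosure (V : Set L) := fun u hu => by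
    refine supClosure_min (t := {b | u + b ∈ supClosure (V : Set L)})
      (fun v hv => subset_supClosure (V.add_mem hu hv)) (fun b hb c hc => ?_) hb
    rw [Set.mem_ofPred_eq, add_sup]
    exact supClosed_supClosure hb hc
  refine supClosure_min (t := {a | a + b ∈ supClosure (V : Set L)}) hadd (fun a ha c hc => ?_) ha
  rw [Set.mem_ofPred_eq, sup_add]
  exact supClosed_supClosure ha hc

variable [IsOrderedModule ℝ L]

/-- The vector sublattice generated by a subspace `V`, described as the set of differences of
finite suprema of elements of `V`. -/
def sublatticeSpan (V : Submodule ℝ L) : Submodule ℝ L where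
  carrier := {p | ∃ a ∈ supClosure (V : Set L), ∃ b ∈ supClosure (V : Set L), a - b = p}
  zero_mem' := ⟨0, subset_supClosure V.zero_mem, 0, subset_supClosure V.zero_mem, sub_zero 0⟩
  add_mem' := by
    rintro _ _ ⟨a, ha, b, hb, rfl⟩ ⟨c, hc, d, hd, rfl⟩
    exact ⟨a + c, add_mem_supClosure V ha hc, b + d, add_mem_supClosure V hb hd,
      add_sub_add_comm a c b d⟩
  smul_mem' := by
    rintro c _ ⟨a, ha, b, hb, rfl⟩
    rcases le_total 0 c with hc | hc
    · exact ⟨c • a, smul_mem_supClosure V hc ha, c • b, smul_mem_supClosure V hc hb,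
        (smul_sub c a b).symm⟩
    · have hc' := neg_nonneg.2 hc
      refine ⟨-c • b, smul_mem_supClosure V hc' hb, -c • a, smul_mem_supClosure V hc' ha, ?_⟩
      rw [← smul_sub, neg_smul, ← smul_neg, neg_sub]

theorem le_sublatticeSpan (V : Submodule ℝ L) : V ≤ sublatticeSpan V := fun v hv =>
  ⟨v, subset_supClosure hv, 0, subset_supClosure V.zero_mem, sub_zero v⟩

theorem sup_mem_sublatticeSpan {V : Submodule ℝ L} {p q : L} (hp : p ∈ sublatticeSpan V)
    (hq : q ∈ sublatticeSpan V) : p ⊔ q ∈ sublatticeSpan V := by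
  obtain ⟨a, ha, b, hb, rfl⟩ := hp
  obtain ⟨c, hc, d, hd, rfl⟩ := hq
  exact ⟨_, supClosed_supClosure (add_mem_supClosure V ha hd) (add_mem_supClosure V hc hb),
    b + d, add_mem_supClosure V hb hd, (sub_sup_sub_eq a b c d).symm⟩

theorem abs_mem_sublatticeSpan {V : Submodule ℝ L} {p : L} (hp : p ∈ sublatticeSpan V) :
    |p| ∈ sublatticeSpan V :=
  sup_mem_sublatticeSpan hp (neg_mem hp)

instance isOrderedModule_prod {𝕜 L M : Type*} [Semiring 𝕜] [PartialOrder 𝕜] [AddCommMonoid L]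
    [PartialOrder L] [Module 𝕜 L] [IsOrderedModule 𝕜 L] [AddCommMonoid M] [PartialOrder M]
    [Module 𝕜 M] [IsOrderedModule 𝕜 M] : IsOrderedModule 𝕜 (L × M) where

end VectorLattice

section SolidNorm

variable {X : Type*} [NormedAddCommGroup X] [Lattice X] [HasSolidNorm X] [IsOrderedAddMonoid X]

theorem norm_posPart_le (u : X) : ‖u⁺‖ ≤ ‖u‖ :=
  norm_le_norm_of_abs_le_abs <| by
    rw [abs_of_nonneg (posPart_nonneg u)]
    exact sup_le (le_abs_self u) (abs_nonneg u)

theorem norm_le_norm_of_nonneg_of_le {u v : X} (hu : 0 ≤ u) (huv : u ≤ v) : ‖u‖ ≤ ‖v‖ :=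
  norm_le_norm_of_abs_le_abs <| by rwa [abs_of_nonneg hu, abs_of_nonneg (hu.trans huv)]

end SolidNorm

section PositiveFunctional

variable {X : Type*} [NormedAddCommGroup X] [NormedSpace ℝ X] [Lattice X] [HasSolidNorm X]
  [IsOrderedAddMonoid X]

theorem sum_abs_comp_le {E ι : Type*} [SeminormedAddCommGroup E] [NormedSpace ℝ E] [Fintype ι]
    {ψ : ι → StrongDual ℝ X} (hψ : ∀ k, Monotone (ψ k)) (T : E →L[ℝ] X) (v : E) :
    ∑ k, |(ψ k ∘L T) v| ≤ ‖∑ k, ψ k‖ * ‖T‖ * ‖v‖ :=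
  calc ∑ k, |(ψ k ∘L T) v| ≤ ∑ k, ψ k |T v| :=
        Finset.sum_le_sum fun k _ => abs_map_le_of_monotone (hψ k) (T v)
    _ = (∑ k, ψ k) |T v| := by rw [sum_apply]
    _ ≤ ‖∑ k, ψ k‖ * ‖|T v|‖ := (le_abs_self _).trans ((∑ k, ψ k).le_opNorm _)
    _ ≤ ‖∑ k, ψ k‖ * ‖T‖ * ‖v‖ := by
        rw [norm_abs_eq_norm, mul_assoc]
        exact mul_le_mul_of_nonneg_left (T.le_opNorm v) (norm_nonneg _)

variable [IsOrderedModule ℝ X]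

/-- Since `u ↦ q u⁺` vanishes on the negative cone, every linear functional below it is positive. -/
theorem exists_monotone_dual_eq_posPart {q : X → ℝ} {C : ℝ} (hC : 0 ≤ C)
    (hsmul : ∀ c : ℝ, 0 < c → ∀ u, q (c • u) = c * q u) (hadd : ∀ u v, q (u + v) ≤ q u + q v)
    (hmono : MonotoneOn q (Set.Ici 0)) (hq : ∀ u, q u ≤ C * ‖u‖) (x : X) :
    ∃ ψ : StrongDual ℝ X, Monotone ψ ∧ ‖ψ‖ ≤ C ∧ ψ x = q x⁺ ∧ ∀ u, ψ u ≤ q u⁺ := by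
  obtain ⟨g, hgx, hg⟩ := exists_linearMap_le_eq (N := fun u => q u⁺)
    (fun c hc u => by rw [smul_posPart_of_pos hc, hsmul c hc])
    (fun u v => (hmono (posPart_nonneg _) (add_nonneg (posPart_nonneg u) (posPart_nonneg v))
      (add_posPart_le u v)).trans (hadd _ _)) x
  have hq_zero : q 0 = 0 := by
    have h := hsmul 2 two_pos 0
    rw [smul_zero] at h
    linarith
  have hg_mono : Monotone g := (monotone_iff_map_nonpos g).2 fun u hu =>
    (hg u).trans_eq (by rw [posPart_eq_zero.2 hu, hq_zero])
  have hg_le : ∀ u, g u ≤ C * ‖u‖ := fun u =>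
    (hg u).trans ((hq _).trans (mul_le_mul_of_nonneg_left (norm_posPart_le u) hC))
  have hg_bound : ∀ u, ‖g u‖ ≤ C * ‖u‖ := fun u =>
    abs_le'.2 ⟨hg_le u, by simpa only [map_neg, norm_neg] using hg_le (-u)⟩
  exact ⟨g.mkContinuous C hg_bound, hg_mono, g.mkContinuous_norm_le hC hg_bound, hgx, hg⟩

theorem exists_monotone_dual_eq_norm {a : X} (ha : 0 ≤ a) :
    ∃ φ : StrongDual ℝ X, Monotone φ ∧ ‖φ‖ ≤ 1 ∧ φ a = ‖a‖ := by
  obtain ⟨φ, hφ, hφ_norm, hφa, -⟩ := exists_monotone_dual_eq_posPart zero_le_one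
    (fun c hc u => by rw [norm_smul, Real.norm_of_nonneg hc.le]) norm_add_le
    (fun u hu v _ huv => norm_le_norm_of_nonneg_of_le hu huv) (fun u => (one_mul ‖u‖).ge) a
  exact ⟨φ, hφ, hφ_norm, by rwa [posPart_of_nonneg ha] at hφa⟩

theorem exists_add_eq_and_map_sup_eq {φ : StrongDual ℝ X} (hφ : Monotone φ) (x y : X) :
    ∃ φ₁ φ₂ : StrongDual ℝ X, Monotone φ₁ ∧ Monotone φ₂ ∧ φ₁ + φ₂ = φ ∧
      φ (x ⊔ y) = φ₁ x + φ₂ y := by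
  obtain ⟨φ₁, hφ₁, -, heq, hle⟩ := exists_monotone_dual_eq_posPart (norm_nonneg φ)
    (fun c _ u => map_smul φ c u) (fun u v => (map_add φ u v).le) (hφ.monotoneOn _)
    (fun u => (le_abs_self _).trans (φ.le_opNorm u)) (x - y)
  refine ⟨φ₁, φ - φ₁, hφ₁, (monotone_iff_map_nonneg _).2 fun u hu => ?_, add_sub_cancel φ₁ φ, ?_⟩
  · have h := hle u
    rw [posPart_of_nonneg hu] at h
    exact sub_nonneg.2 h
  · rw [sup_eq_add_posPart_sub, map_add, ← heq, map_sub, sub_apply]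
    ring

end PositiveFunctional

namespace FBLRe

open FreeBL

section Norm

variable {E : Type*} [NormedAddCommGroup E] [NormedSpace ℂ E]

theorem sum_abs_le_of_mem_weakUnit (f : FBLRe E) {n : ℕ} {ψ : Fin n → StrongDual ℝ E}
    (hψ : ⟨n, ψ⟩ ∈ weakUnit ℝ E) : ∑ k, |f.1 (ψ k)| ≤ 2 * ‖f‖ := by
  have htop : 2 * cNorm f.1 ≠ ⊤ := ENNReal.mul_ne_top (by simp) (cNorm_lt_top f).ne
  calc ∑ k, |f.1 (ψ k)| ≤ (2 * cNorm f.1).toReal :=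
        (ENNReal.ofReal_le_iff_le_toReal htop).1
          ((le_tupleNorm hψ f.1).trans (le_cNorm f.2.1.1))
    _ = 2 * ‖f‖ := by rw [ENNReal.toReal_mul, norm_def, ENNReal.toReal_ofNat]

theorem sum_abs_le (f : FBLRe E) {n : ℕ} {ψ : Fin n → StrongDual ℝ E} {C : ℝ}
    (hC : 0 ≤ C) (hψ : ∀ v, ∑ k, |ψ k v| ≤ C * ‖v‖) : ∑ k, |f.1 (ψ k)| ≤ 2 * C * ‖f‖ := by
  rcases hC.eq_or_lt with rfl | hC
  · have hψ_zero : ∀ k, ψ k = 0 := fun k => ContinuousLinearMap.ext fun v =>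
      abs_nonpos_iff.1 <| (Finset.single_le_sum (f := fun k => |ψ k v|)
        (fun _ _ => abs_nonneg _) (Finset.mem_univ k)).trans ((hψ v).trans_eq (zero_mul _))
    have hf_zero : f.1 0 = 0 := by simpa using f.2.1.1 0 0 le_rfl
    simp [hψ_zero, hf_zero]
  · have hmem : ⟨n, fun k => C⁻¹ • ψ k⟩ ∈ weakUnit ℝ E := fun v hv => by
      calc ∑ k, ‖(C⁻¹ • ψ k) v‖ = C⁻¹ * ∑ k, |ψ k v| := by
            simp [Finset.mul_sum, abs_of_pos hC]
        _ ≤ C⁻¹ * (C * 1) := by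
            gcongr
            exact (hψ v).trans (by gcongr)
        _ = 1 := by rw [mul_one, inv_mul_cancel₀ hC.ne']
    calc ∑ k, |f.1 (ψ k)| = C * ∑ k, |f.1 (C⁻¹ • ψ k)| := by
          simp [hom_of_mem f.2 _ _ (inv_nonneg.2 hC.le), abs_mul, abs_of_pos hC, ← Finset.mul_sum,
            mul_inv_cancel_left₀ hC.ne']
      _ ≤ C * (2 * ‖f‖) :=
          mul_le_mul_of_nonneg_left (sum_abs_le_of_mem_weakUnit f hmem) hC.le
      _ = 2 * C * ‖f‖ := by ring

end Norm

section Generated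

variable {E : Type*} [NormedAddCommGroup E] [NormedSpace ℂ E]

theorem dense_of_deltaRe_mem {M : Submodule ℝ (FBLRe E)} (hδ : ∀ z, deltaRe z ∈ M)
    (hsup : ∀ f ∈ M, ∀ g ∈ M, f ⊔ g ∈ M) : Dense (M : Set (FBLRe E)) := by
  let val : FBLRe E →ₗ[ℝ] (StrongDual ℝ E → ℝ) := (FBL E).subtype
  have hgen : generated E ≤ M.map val := sInf_le
    ⟨fun z => ⟨deltaRe z, hδ z, rfl⟩, by
      rintro _ ⟨f, hf, rfl⟩ _ ⟨g, hg, rfl⟩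
      exact ⟨f ⊔ g, hsup f hf g hg, rfl⟩⟩
  refine fun f => Metric.mem_closure_iff.2 fun ε hε => ?_
  obtain ⟨_, hg, hfg⟩ := f.2.2 (ENNReal.ofReal (ε / 2)) (ENNReal.ofReal_pos.2 (half_pos hε))
  obtain ⟨g, hgM, rfl⟩ := hgen hg
  refine ⟨g, hgM, ?_⟩
  calc dist f g = (cNorm (f.1 - g.1)).toReal := dist_eq_norm f g
    _ ≤ ε / 2 := ENNReal.toReal_le_of_le_ofReal (half_pos hε).le ((cNorm_le _).trans hfg)
    _ < ε := half_lt_self hε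

theorem eq_of_eqOn_deltaRe {Y : Type*} [NormedAddCommGroup Y] [NormedSpace ℝ Y] [Lattice Y]
    {S S' : FBLRe E →L[ℝ] Y} (hS : ∀ f g, S (f ⊔ g) = S f ⊔ S g)
    (hS' : ∀ f g, S' (f ⊔ g) = S' f ⊔ S' g) (h : ∀ z, S (deltaRe z) = S' (deltaRe z)) :
    S = S' := by
  have hdense : Dense (LinearMap.eqLocus S.toLinearMap S'.toLinearMap : Set (FBLRe E)) :=
    dense_of_deltaRe_mem h fun f hf g hg =>
      (hS f g).trans ((congrArg₂ (· ⊔ ·) hf hg).trans (hS' f g).symm)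
  exact ContinuousLinearMap.coeFn_injective
    (Continuous.ext_on hdense S.continuous S'.continuous fun _ hf => hf)

variable (E) in
/-- The evaluation map `δ_{E_ℝ}` as a real linear map. -/
noncomputable def deltaReₗ : E →ₗ[ℝ] FBLRe E where
  toFun := deltaRe
  map_add' z w := FBLRe.ext fun φ => map_add φ z w
  map_smul' c z := FBLRe.ext fun φ => map_smul φ c z

@[simp] theorem deltaReₗ_apply (z : E) : deltaReₗ E z = deltaRe z := rfl

end Generated

section Lift

variable {E : Type*} [NormedAddCommGroup E] [NormedSpace ℂ E] {X : Type*} [NormedAddCommGroup X]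
  [NormedSpace ℝ X] [Lattice X] {T : E →L[ℝ] X}

theorem apply_comp_le_of_mem_supClosure {a : FBLRe E × X}
    (ha : a ∈ supClosure (LinearMap.range ((deltaReₗ E).prod T.toLinearMap) : Set (FBLRe E × X)))
    {ψ : StrongDual ℝ X} (hψ : Monotone ψ) : a.1.1 (ψ ∘L T) ≤ ψ a.2 := by
  refine supClosure_min (t := {a : FBLRe E × X | a.1.1 (ψ ∘L T) ≤ ψ a.2}) ?_ ?_ ha
  · rintro _ ⟨z, rfl⟩
    exact le_refl (ψ (T z))
  · exact fun a ha b hb => max_le (ha.trans (hψ le_sup_left)) (hb.trans (hψ le_sup_right))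

variable [IsOrderedAddMonoid X] [IsOrderedModule ℝ X] (T)

/-- The vector sublattice of `FBL[E_ℝ] × X` generated by the pairs `(δ_z, T z)`: the graph of the
lattice homomorphism induced by `T` on the sublattice generated by the evaluations. -/
noncomputable def liftGraph : Submodule ℝ (FBLRe E × X) :=
  sublatticeSpan (LinearMap.range ((deltaReₗ E).prod T.toLinearMap))

variable {T}

theorem denseRange_fst_liftGraph :
    DenseRange ((LinearMap.fst ℝ (FBLRe E) X).domRestrict (liftGraph T)) := by
  have h : Dense ((liftGraph T).map (LinearMap.fst ℝ (FBLRe E) X) : Set (FBLRe E)) := by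
    refine dense_of_deltaRe_mem
      (fun z => ⟨(deltaRe z, T z), le_sublatticeSpan _ ⟨z, rfl⟩, rfl⟩) ?_
    rintro _ ⟨p, hp, rfl⟩ _ ⟨q, hq, rfl⟩
    exact ⟨p ⊔ q, sup_mem_sublatticeSpan hp hq, rfl⟩
  rwa [DenseRange, ← LinearMap.coe_range, LinearMap.range_domRestrict]

variable [HasSolidNorm X]

theorem exists_decomposition_le_of_mem_supClosure {a : FBLRe E × X}
    (ha : a ∈ supClosure (LinearMap.range ((deltaReₗ E).prod T.toLinearMap) : Set (FBLRe E × X)))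
    {φ : StrongDual ℝ X} (hφ : Monotone φ) :
    ∃ (n : ℕ) (ψ : Fin n → StrongDual ℝ X), (∀ k, Monotone (ψ k)) ∧ ∑ k, ψ k = φ ∧
      φ a.2 ≤ ∑ k, a.1.1 (ψ k ∘L T) := by
  suffices h : a ∈ {a : FBLRe E × X | ∀ φ : StrongDual ℝ X, Monotone φ →
      ∃ (n : ℕ) (ψ : Fin n → StrongDual ℝ X), (∀ k, Monotone (ψ k)) ∧ ∑ k, ψ k = φ ∧
        φ a.2 ≤ ∑ k, a.1.1 (ψ k ∘L T)} from h φ hφ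
  refine supClosure_min ?_ ?_ ha
  · rintro _ ⟨z, rfl⟩ φ hφ
    exact ⟨1, fun _ => φ, fun _ => hφ, by simp, by simp⟩
  · intro a ha b hb φ hφ
    obtain ⟨φ₁, φ₂, hφ₁, hφ₂, hadd, hsup⟩ := exists_add_eq_and_map_sup_eq hφ a.2 b.2
    obtain ⟨m, ψ, hψ, hψ_sum, hψ_le⟩ := ha φ₁ hφ₁
    obtain ⟨n, χ, hχ, hχ_sum, hχ_le⟩ := hb φ₂ hφ₂
    refine ⟨m + n, Fin.append ψ χ, Fin.addCases (by simpa using hψ) (by simpa using hχ), ?_, ?_⟩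
    · simp only [Fin.sum_univ_add, Fin.append_left, Fin.append_right, hψ_sum, hχ_sum, hadd]
    · simp only [Fin.sum_univ_add, Fin.append_left, Fin.append_right]
      calc φ (a ⊔ b).2 = φ₁ a.2 + φ₂ b.2 := hsup
        _ ≤ ∑ k, a.1.1 (ψ k ∘L T) + ∑ k, b.1.1 (χ k ∘L T) := add_le_add hψ_le hχ_le
        _ ≤ _ := add_le_add (Finset.sum_le_sum fun _ _ => le_sup_left)
            (Finset.sum_le_sum fun _ _ => le_sup_right)

theorem map_snd_le_of_mem_liftGraph {p : FBLRe E × X} (hp : p ∈ liftGraph T)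
    {φ : StrongDual ℝ X} (hφ : Monotone φ) : φ p.2 ≤ 2 * (‖φ‖ * ‖T‖) * ‖p.1‖ := by
  obtain ⟨a, ha, b, hb, rfl⟩ := hp
  obtain ⟨n, ψ, hψ, rfl, hle⟩ := exists_decomposition_le_of_mem_supClosure ha hφ
  calc (∑ k, ψ k) (a - b).2 = (∑ k, ψ k) a.2 - ∑ k, ψ k b.2 := by
        rw [Prod.snd_sub, map_sub, sum_apply _ ψ b.2]
    _ ≤ ∑ k, a.1.1 (ψ k ∘L T) - ∑ k, b.1.1 (ψ k ∘L T) := sub_le_sub hle <|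
        Finset.sum_le_sum fun k _ => apply_comp_le_of_mem_supClosure hb (hψ k)
    _ = ∑ k, (a - b).1.1 (ψ k ∘L T) := Finset.sum_sub_distrib ..|>.symm
    _ ≤ ∑ k, |(a - b).1.1 (ψ k ∘L T)| := Finset.sum_le_sum fun _ _ => le_abs_self _
    _ ≤ _ := sum_abs_le _ (by positivity) (sum_abs_comp_le hψ T)

theorem norm_snd_le_of_mem_liftGraph {p : FBLRe E × X} (hp : p ∈ liftGraph T) :
    ‖p.2‖ ≤ 2 * ‖T‖ * ‖p.1‖ := by
  obtain ⟨φ, hφ, hφ_norm, hφp⟩ := exists_monotone_dual_eq_norm (abs_nonneg p.2)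
  calc ‖p.2‖ = φ |p|.2 := by rw [← norm_abs_eq_norm, ← hφp]; rfl
    _ ≤ 2 * (‖φ‖ * ‖T‖) * ‖|p|.1‖ := map_snd_le_of_mem_liftGraph (abs_mem_sublatticeSpan hp) hφ
    _ = 2 * (‖φ‖ * ‖T‖) * ‖p.1‖ := congrArg _ (norm_abs_eq_norm p.1)
    _ ≤ 2 * (1 * ‖T‖) * ‖p.1‖ := by gcongr
    _ = 2 * ‖T‖ * ‖p.1‖ := by rw [one_mul]

variable [CompleteSpace X] (T)

/-- The lattice homomorphism `FBL[E_ℝ] → X` which extends `T : E → X`. -/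
noncomputable def lift : FBLRe E →L[ℝ] X :=
  ((LinearMap.snd ℝ (FBLRe E) X).domRestrict (liftGraph T)).extendOfNorm
    ((LinearMap.fst ℝ (FBLRe E) X).domRestrict (liftGraph T))

variable {T}

theorem lift_fst {p : FBLRe E × X} (hp : p ∈ liftGraph T) : lift T p.1 = p.2 :=
  LinearMap.extendOfNorm_eq (f := (LinearMap.snd ℝ (FBLRe E) X).domRestrict (liftGraph T))
    denseRange_fst_liftGraph ⟨2 * ‖T‖, fun q => by
      simpa only [LinearMap.domRestrict_apply, LinearMap.fst_apply, LinearMap.snd_apply]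
        using norm_snd_le_of_mem_liftGraph q.2⟩ ⟨p, hp⟩

variable (T)

@[simp] theorem lift_deltaRe (z : E) : lift T (deltaRe z) = T z :=
  lift_fst (p := (deltaRe z, T z)) (le_sublatticeSpan _ ⟨z, rfl⟩)

theorem lift_sup (f g : FBLRe E) : lift T (f ⊔ g) = lift T f ⊔ lift T g := by
  refine denseRange_fst_liftGraph (T := T).induction_on₂
    (isClosed_eq (by fun_prop) (by fun_prop)) (fun p q => ?_) f g
  exact (lift_fst (sup_mem_sublatticeSpan p.2 q.2)).trans
    (congrArg₂ (· ⊔ ·) (lift_fst p.2) (lift_fst q.2)).symm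

end Lift

end FBLRe

section Complexification

variable {X : Type*} [NormedAddCommGroup X] [NormedSpace ℝ X] [Lattice X] [HasSolidNorm X]
  [IsOrderedAddMonoid X] [IsOrderedModule ℝ X] [CompleteSpace X]

namespace Cplx

variable (X) in
/-- The real part `X_ℂ → X` as a continuous real linear map. -/
noncomputable def reCLM : Cplx X →L[ℝ] X :=
  LinearMap.mkContinuous
    { toFun := re
      map_add' := add_re
      map_smul' := fun c z => by rw [← Complex.coe_smul, smul_re]; simp }
    1 fun z => (norm_re_le z).trans_eq (one_mul ‖z‖).symm

@[simp] theorem reCLM_apply (z : Cplx X) : reCLM X z = z.re := rfl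

variable {Y : Type*} [NormedAddCommGroup Y] [NormedSpace ℝ Y] [Lattice Y] [HasSolidNorm Y]
  [IsOrderedAddMonoid Y] [IsOrderedModule ℝ Y] [CompleteSpace Y]
  {Z : Type*} [NormedAddCommGroup Z] [NormedSpace ℝ Z] [Lattice Z] [HasSolidNorm Z]
  [IsOrderedAddMonoid Z] [IsOrderedModule ℝ Z] [CompleteSpace Z]

theorem IsLatticeHom.comp {T : Cplx Y →L[ℂ] Cplx Z} {S : Cplx X →L[ℂ] Cplx Y}
    (hT : IsLatticeHom T) (hS : IsLatticeHom S) : IsLatticeHom (T ∘L S) := by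
  obtain ⟨T, hT_sup, hT_inf, rfl⟩ := hT
  obtain ⟨S, hS_sup, hS_inf, rfl⟩ := hS
  exact ⟨T ∘L S, fun x y => (congrArg T (hS_sup x y)).trans (hT_sup _ _),
    fun x y => (congrArg T (hS_inf x y)).trans (hT_inf _ _), rfl⟩

end Cplx

namespace FBLC

variable {E : Type*} [NormedAddCommGroup E] [NormedSpace ℂ E]

theorem eq_of_eqOn_deltaC {S S' : FBLC E →L[ℂ] Cplx X} (hS : Cplx.IsLatticeHom S)
    (hS' : Cplx.IsLatticeHom S') (h : ∀ z, S (deltaC z) = S' (deltaC z)) : S = S' := by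
  obtain ⟨R, hR, -, rfl⟩ := hS
  obtain ⟨R', hR', -, rfl⟩ := hS'
  rw [FBLRe.eq_of_eqOn_deltaRe hR hR' fun z => congrArg Cplx.re (h z)]

/-- The complex lattice homomorphism `FBL_ℂ[E] → X_ℂ` which extends `T : E → X_ℂ`; it is the
complexification of the extension of `Re T`. -/
noncomputable def lift (T : E →L[ℂ] Cplx X) : FBLC E →L[ℂ] Cplx X :=
  Cplx.map (FBLRe.lift (Cplx.reCLM X ∘L T.restrictScalars ℝ))

variable (T : E →L[ℂ] Cplx X)

theorem isLatticeHom_lift : Cplx.IsLatticeHom (lift T) :=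
  ⟨_, FBLRe.lift_sup _, map_inf_of_map_sup (FBLRe.lift_sup _), rfl⟩

@[simp] theorem lift_deltaC (z : E) : lift T (deltaC z) = T z := by
  ext <;> simp [lift, deltaC_apply]

end FBLC

end Complexification

theorem propositionp {X : Type*} [NormedAddCommGroup X] [NormedSpace ℝ X] [Lattice X]
    [HasSolidNorm X] [IsOrderedAddMonoid X] [IsOrderedModule ℝ X] [CompleteSpace X]
    (T : Cplx X →L[ℂ] Cplx X) (hT : Cplx.IsLatticeHom T) :
    spectrum ℂ T ⊆ spectrum ℂ (inducedHom T) := by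
  have hβ := FBLC.isLatticeHom_lift (.id ℂ (Cplx X))
  refine spectrum_subset_of_retraction deltaC (FBLC.lift (.id ℂ (Cplx X))) ?_ ?_ ?_
  · exact ContinuousLinearMap.ext fun z => FBLC.lift_deltaC _ z
  · exact ContinuousLinearMap.ext (inducedHom_deltaC T)
  · exact FBLC.eq_of_eqOn_deltaC (hβ.comp (isLatticeHom_inducedHom T)) (hT.comp hβ) fun z => by
      simp [inducedHom_deltaC]
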